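/- **Setting.** Let $0\neq|a|<M$, $r_+=M+\sqrt{M^2-a^2}$, $\Delta=r^2-2Mr+a^2$, and $'=\frac{d}{dr^*}=\frac{\Delta}{r^2+a^2}\frac{d}{dr}$. A triple $(\omega,m,\Lambda)\in\mathbb R\times\mathbb Z\times\mathbb R$ is *admissible* if $\Lambda\ge|m|(|m|+1)$ and $\Lambda\ge|am\omega|$; for such a triple put $$V_0(r)=\frac{4Mram\omega-a^2m^2+\Delta\Lambda}{(r^2+a^2)^2}.$$ For $\epsilon>0$ let $I_{\rm gensuper}=(-\epsilon,(2Mr_+)^{-1}+\epsilon)$ and $I_{\rm strictsuper}=(\epsilon/2,(2Mr_+)^{-1}-\epsilon/2)$. Let $I_{\rm nonsuper}\subset\mathbb R\setminus[0,(2Mr_+)^{-1}]$ be an open set with two connected components, without limit points at $0$ and $(2Mr_+)^{-1}$, and with $I_{\rm nonsuper}\cup I_{\rm gensuper}=\mathbb R$; i.e. $I_{\rm nonsuper}=(-\infty,-\delta_1)\cup((2Mr_+)^{-1}+\delta_2,\infty)$ with $0<\delta_1,\delta_2<\epsilon$. Let $g$ be the Kerr metric with parameters $a,M$, and let $T=\partial_t$,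 $\Omega_1=\partial_\phi$ in Boyer–Lindquist coordinates $(t,r,\theta,\phi)$. For positive parameters $\omega_{\rm high},\epsilon_{\rm width},\alpha$, let $\mathcal G_\natural$ be the set of admissible triples with $|\omega|\ge\omega_{\rm high}$, $\epsilon_{\rm width}\Lambda\le\omega^2\le\epsilon_{\rm width}^{-1}\Lambda$ and $m\omega\notin(0,\frac{am^2}{2Mr_+}+\alpha\Lambda]$. For $b_{\rm trap}>0$ let $\mathcal G_\natural(b_{\rm trap})$ be the set of those triples in $\mathcal G_\natural$ for which $V_0$ has an interior local maximum $r^0_{\max}\in(r_+,\infty)$ with $|V_0(r^0_{\max})-\omega^2|\le b_{\rm trap}\omega^2$. A *trapping degeneration function* is a function $\chi_\natural(r,\omega,m,\Lambda)\ge0$, defined for $r>r_+$ and admissible triples, such that $\chi_\natural\equiv1$ for triples outside $\mathcal G_\natural(b_{\rm trap})$, and for each triple in $\mathcal G_\natural(b_{\rm trap})$: $\chi_\natural$ is smooth in $r$; it vanishes at $r^0_{\max}$; $\chi_\natural''\ge\kappa$ wherever $\chi_\natural\le\frac12$, with a constant $\kappa>0$ independent of the triple; and $\{r>r_+:\chi_\natural\le\frac12\}$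 is an interval. **Proposition.** There are $r_0\in(r_+,2.01M]$ and $R_0\ge5M$, depending only on $a,M$, such that for every $R_{\rm pot}>R_0$, every sufficiently small $\epsilon>0$ (depending on $a,M,R_{\rm pot}$), every $I_{\rm nonsuper}$ as above and every $r_{\rm pot}\in(r_+,r_0)$ the following holds. There exist integers $N_s\ge2$ and $N\ge N_s+2$, nonempty connected open intervals $I_1,\dots,I_N$ with $\bigcup_{n=1}^NI_n=\mathbb R$, numbers $\alpha_n\in\mathbb R$, nondegenerate intervals $[r_{n,1},r_{n,2}]\subset(r_{\rm pot},R_{\rm pot})$, and $b_{\rm pot},b'_{\rm pot}>0$, with the properties below. The constants implicit in $\gtrsim$ are positive and independent of $r$, $n$ and $(\omega,m,\Lambda)$. 1. $0\in I_1$, $(2Mr_+)^{-1}\in I_2$, $I_3,\dots,I_{N_s}\subset I_{\rm strictsuper}$, $\bigcup_{n=1}^{N_s}I_n=I_{\rm gensuper}$, $\bigcup_{n=N_s+1}^{N}I_n=I_{\rm nonsuper}$; $I_{N-1}$ is unbounded below and $I_N$ is unbounded above. 2. For $n=1,\dots,N_s$ one has $\alpha_n=\frac a{2Mr_+}$, and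 for all admissible $(\omega,m\ne0,\Lambda)$ with $\omega/(am)\in I_n$: $$\{r>r_+:V_0-\omega^2<b_{\rm pot}\omega^2,\ V_0'>0\}\subset(r_+,r_{n,1}),\qquad \{r>r_+:V_0-\omega^2<b_{\rm pot}\omega^2,\ V_0'<0\}\subset(r_{n,2},\infty),$$ $$[r_{n,1},r_{n,2}]\subset\{r>r_+:V_0-\omega^2\ge b_{\rm pot}\omega^2\},$$ $$\{r_+<r<2R_{\rm pot}:|V_0-\omega^2|\le b_{\rm pot}\omega^2,\ |V_0'|\le b'_{\rm pot}\Delta r^{-2}\omega^2\}=\emptyset,$$ and $V_0'\gtrsim\Delta r^{-2}(\Lambda+\omega^2)$ in $(r_+,r_{\rm pot}]$. 3. For $n=2,\dots,N$ and all admissible $(\omega,m\neq0,\Lambda)$ with $\omega/(am)\in I_n$: $\omega^2+V_0\gtrsim\Delta\Lambda$ in $\{r_+\le r\le1.2R_{\rm pot}\}\cap\{V_0\ge\omega^2\}$. 4. $[r_{1,1},r_{1,2}]\subset(4M,6M)$, and for all admissible $(\omega,m\ne0,\Lambda)$ with $\omega/(am)\in I_1$: $V_0'\gtrsim\Delta r^{-2}(\Lambda+\omega^2)$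 in $(r_+,2.1M]$, $V_0\gtrsim r^{-2}(\Lambda+\omega^2)$ in $[2.01M,\infty)$, and $V_0>\frac12\omega^2$ in $[2.01M,1.2R_{\rm pot}]$. 5. For $n=N_s+1,\dots,N$ and all admissible $(\omega,m,\Lambda)$ such that either $m\ne0$ and $\omega/(am)\in I_n$, or $n=N-1$, $m=0$, $a\omega<0$, or $n=N$, $m=0$, $a\omega>0$: $$\{r>r_+:|V_0-\omega^2|<b_{\rm pot}\omega^2,\ V_0'>0\}\subset(r_+,r_{n,2}),\qquad \{r>r_+:|V_0-\omega^2|<b_{\rm pot}\omega^2,\ V_0'<0\}\subset(r_{n,1},\infty),$$ $$\{r_+<r<2R_{\rm pot}:|V_0-\omega^2|<b_{\rm pot}\omega^2,\ |V_0'|<b'_{\rm pot}\Delta r^{-2}\omega^2\}\subset(r_{n,1},r_{n,2}).$$ 6. For $n=N_s+1,\dots,N$ one has $0\le\alpha_n\frac{2Mr_+}a\le1$, and there is a constant $\beta<0$ with $g(T+\alpha_n\Omega_1,T+\alpha_n\Omega_1)\le\beta$ in $\{r_{n,1}<r<r_{n,2}\}$ for all these $n$. Moreover $\alpha_{N-1}=\alpha_N=0$.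 7. If $b_{\rm trap}>0$ is sufficiently small, then for all positive $\omega_{\rm high},\epsilon_{\rm width},\alpha,\kappa$ there is $c'>0$ such that every trapping degeneration function $\chi_\natural$ with these parameters satisfies: $\chi_\natural(r,\omega,m,\Lambda)=1$ for all $r>r_+$, all $n\le N_s$ and all triples as in 2; and $\chi_\natural(r,\omega,m,\Lambda)\ge c'$ for all $n=N_s+1,\dots,N$, all triples as in 5 and all $r\in(r_+,r_{n,1}]\cup[r_{n,2},\infty)$. -/

import Mathlib

open Set

noncomputable section

namespace Kerr

/-- The event horizon radius `r₊ = M + √(M² - a²)`. -/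
def rPlus (M a : ℝ) : ℝ := M + Real.sqrt (M ^ 2 - a ^ 2)

/-- `Δ = r² - 2Mr + a²`. -/
def Delta (M a r : ℝ) : ℝ := r ^ 2 - 2 * M * r + a ^ 2

/-- The superradiant threshold `(2 M r₊)⁻¹` for the ratio `ω / (a m)`. -/
def gammaPlus (M a : ℝ) : ℝ := (2 * M * rPlus M a)⁻¹

/-- The operator `d/dr* = Δ / (r² + a²) · d/dr`, on functions of `r`. -/
def rStarDeriv (M a : ℝ) (f : ℝ → ℝ) (r : ℝ) : ℝ :=
  Delta M a r / (r ^ 2 + a ^ 2) * deriv f r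

/-- Admissible frequency triples `(ω, m, Λ)`. -/
def Admissible (a ω : ℝ) (m : ℤ) (Λ : ℝ) : Prop :=
  |(m : ℝ)| * (|(m : ℝ)| + 1) ≤ Λ ∧ |a * m * ω| ≤ Λ

/-- The high frequency potential `V₀(ω, m, Λ, r)`. -/
def V0 (M a ω : ℝ) (m : ℤ) (Λ r : ℝ) : ℝ :=
  (4 * M * r * a * m * ω - a ^ 2 * (m : ℝ) ^ 2 + Delta M a r * Λ) / (r ^ 2 + a ^ 2) ^ 2

/-- `V₀' = dV₀/dr*`. -/
def V0' (M a ω : ℝ) (m : ℤ) (Λ r : ℝ) : ℝ :=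
  rStarDeriv M a (V0 M a ω m Λ) r

/-- `ρ² = r² + a² cos² θ`. -/
def rhoSq (a r θ : ℝ) : ℝ := r ^ 2 + a ^ 2 * Real.cos θ ^ 2

/-- The Kerr metric at a point with Boyer-Lindquist coordinates `(t, r, θ, φ)`, as a bilinear form
in the components of vectors with respect to `∂_t, ∂_r, ∂_θ, ∂_φ` (indices `0, 1, 2, 3`). -/
def metric (M a r θ : ℝ) (u v : Fin 4 → ℝ) : ℝ :=
  -(Delta M a r / rhoSq a r θ) *
      (u 0 - a * Real.sin θ ^ 2 * u 3) * (v 0 - a * Real.sin θ ^ 2 * v 3)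
    + rhoSq a r θ / Delta M a r * u 1 * v 1
    + rhoSq a r θ * u 2 * v 2
    + Real.sin θ ^ 2 / rhoSq a r θ *
      (a * u 0 - (r ^ 2 + a ^ 2) * u 3) * (a * v 0 - (r ^ 2 + a ^ 2) * v 3)

/-- The stationary Killing field `T = ∂_t`. -/
def T : Fin 4 → ℝ := Pi.single 0 1

/-- The axisymmetric Killing field `Ω₁ = ∂_φ`. -/
def Omega1 : Fin 4 → ℝ := Pi.single 3 1

/-- The range `𝒢_♮` of admissible triples, with its parameters `ω_high`, `ε_width`, `α`. -/
def NaturalRange (M a ωhigh εwidth α ω : ℝ) (m : ℤ) (Λ : ℝ) : Prop :=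
  Admissible a ω m Λ ∧ ωhigh ≤ |ω| ∧ εwidth * Λ ≤ ω ^ 2 ∧ ω ^ 2 ≤ εwidth⁻¹ * Λ ∧
    (m : ℝ) * ω ∉ Ioc 0 (a * (m : ℝ) ^ 2 / (2 * M * rPlus M a) + α * Λ)

/-- `r` is an interior local maximum point of `V₀` on `(r₊, ∞)`. -/
def IsInteriorMax (M a ω : ℝ) (m : ℤ) (Λ r : ℝ) : Prop :=
  rPlus M a < r ∧ IsLocalMax (V0 M a ω m Λ) r

/-- The range `𝒢_♮(b_trap)`: the triples of `𝒢_♮` for which `V₀` has an interior maximum, with value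
`V_max` satisfying `|V_max - ω²| ≤ b_trap ω²`. -/
def TrappedRange (M a ωhigh εwidth α btrap ω : ℝ) (m : ℤ) (Λ : ℝ) : Prop :=
  NaturalRange M a ωhigh εwidth α ω m Λ ∧
    ∃ r, IsInteriorMax M a ω m Λ r ∧ |V0 M a ω m Λ r - ω ^ 2| ≤ btrap * ω ^ 2

/-- `χ(r, ω, m, Λ)` is a trapping degeneration function `χ_♮` for the range `𝒢_♮(b_trap)`. The
constant `κ` is the one implicit in `χ'' ≳ 1`; it does not depend on the frequency triple. The last
field says that for each triple the function degenerates in one single well only. -/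
structure IsTrappingDegeneration (M a ωhigh εwidth α btrap κ : ℝ)
    (χ : ℝ → ℝ → ℤ → ℝ → ℝ) : Prop where
  nonneg : ∀ r ω m Λ, rPlus M a < r → Admissible a ω m Λ → 0 ≤ χ r ω m Λ
  eq_one : ∀ r ω m Λ, rPlus M a < r → Admissible a ω m Λ →
    ¬ TrappedRange M a ωhigh εwidth α btrap ω m Λ → χ r ω m Λ = 1
  smooth : ∀ ω m Λ, TrappedRange M a ωhigh εwidth α btrap ω m Λ →
    ContDiffOn ℝ (⊤ : ℕ∞) (fun r => χ r ω m Λ) (Ioi (rPlus M a))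
  vanish : ∀ r ω m Λ, TrappedRange M a ωhigh εwidth α btrap ω m Λ →
    IsInteriorMax M a ω m Λ r → χ r ω m Λ = 0
  convex : ∀ r ω m Λ, rPlus M a < r → TrappedRange M a ωhigh εwidth α btrap ω m Λ →
    χ r ω m Λ ≤ 1 / 2 → κ ≤ rStarDeriv M a (rStarDeriv M a (fun s => χ s ω m Λ)) r
  single_well : ∀ ω m Λ, TrappedRange M a ωhigh εwidth α btrap ω m Λ →
    OrdConnected {r | rPlus M a < r ∧ χ r ω m Λ ≤ 1 / 2}

/-- The generalised superradiant range `I_gensuper = (-ε, (2Mr₊)⁻¹ + ε)` of `ω / (a m)`. -/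
def genSuper (M a ε : ℝ) : Set ℝ := Ioo (-ε) (gammaPlus M a + ε)

/-- The range `I_strictsuper = (ε/2, (2Mr₊)⁻¹ - ε/2)`. -/
def strictSuper (M a ε : ℝ) : Set ℝ := Ioo (ε / 2) (gammaPlus M a - ε / 2)

/-- The non-superradiant range `I_nonsuper`. For `0 < δ₁, δ₂ < ε` these are exactly the open subsets
of `ℝ ∖ [0, (2Mr₊)⁻¹]` with two connected components which do not accumulate at `0` or `(2Mr₊)⁻¹`
and which together with `I_gensuper` cover `ℝ`. -/
def nonSuper (M a δ₁ δ₂ : ℝ) : Set ℝ := Iio (-δ₁) ∪ Ioi (gammaPlus M a + δ₂)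

/-- `(ω, m)` has `m ≠ 0` and `ω / (a m) ∈ I`. -/
def RatioIn (a : ℝ) (I : Set ℝ) (ω : ℝ) (m : ℤ) : Prop := m ≠ 0 ∧ ω / (a * m) ∈ I

/-- The frequency pairs attached to the `n`-th range, where `m = 0` is included in the range `N - 1`
if `a ω < 0` and in the range `N` if `a ω > 0`. -/
def InRange (a : ℝ) (I : ℕ → Set ℝ) (N n : ℕ) (ω : ℝ) (m : ℤ) : Prop :=
  RatioIn a (I n) ω m ∨ (n + 1 = N ∧ m = 0 ∧ a * ω < 0) ∨ (n = N ∧ m = 0 ∧ 0 < a * ω)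

end Kerr

end

/-!
Write `ω = γ · am`. Up to positive factors, `V₀ - ω²` and `V₀'` are affine in `(am)²`, which ranges
over `[0, a² Λ]`, so their signs are decided at the two endpoints and become conditions on `γ` and
`r` alone.

For superradiant `γ` there is a radius at which `V₀ - ω²` is bounded below by a multiple of `Λ`.
The numerator of `dV₀/dr` is positive at the horizon and concave beyond it, so it changes sign at
most once, and wherever `V₀ ≤ ω²` the potential increases on the near side of this radius and
decreases on the far side.

For the other `γ` put `t = γ⁻¹`. Eliminating `Λ` with `V₀ = ω²` turns the slope into a positive
multiple of `(r² + a² - t) (cubic - 2 (r - M) t)`, so critical points at the level `ω²` lie close to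
the single root `ρ` of the second factor beyond the horizon. At `r = ρ` the Killing field
`T + a (ρ² + a²)⁻¹ Ω₁` is timelike.

All these properties are open in `γ`, so compactness covers the bounded ratios by finitely many
ranges, and the limits `γ → ±∞` are ranges with Killing field `T`. A trapping degeneration function
is convex with second derivative at least `κ` where it is at most `1/2`, and it attains its minimum
`0` at the trapped radius; hence it grows at least quadratically away from the window.
-/

noncomputable section

namespace Kerr

open Filter Topology

variable {M a : ℝ}

/-- The potential `V₀`, with `a m` replaced by a real number `k`. -/
def pot (M a k ω Λ r : ℝ) : ℝ :=
  (4 * M * r * k * ω - k ^ 2 + Delta M a r * Λ) / (r ^ 2 + a ^ 2) ^ 2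

/-- The coefficient of `Λ` in the numerator of `dV₀/dr`. -/
def cubic (M a r : ℝ) : ℝ := -2 * r ^ 3 + 6 * M * r ^ 2 - 2 * a ^ 2 * r - 2 * M * a ^ 2

/-- The numerator of `dV₀/dr`, whose denominator is `(r² + a²)³`. -/
def potSlope (M a k ω Λ r : ℝ) : ℝ :=
  Λ * cubic M a r + k * ω * (4 * M * a ^ 2 - 12 * M * r ^ 2) + 4 * r * k ^ 2

/-- `dV₀/dr*`, with `a m` replaced by a real number `k`. -/
def pot' (M a k ω Λ r : ℝ) : ℝ := Delta M a r * potSlope M a k ω Λ r / (r ^ 2 + a ^ 2) ^ 4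

theorem V0_eq_pot (M a ω : ℝ) (m : ℤ) (Λ : ℝ) : V0 M a ω m Λ = pot M a (a * m) ω Λ := by
  funext r
  unfold V0 pot
  congr 1
  ring

theorem hasDerivAt_pot (ha : a ≠ 0) (k ω Λ r : ℝ) :
    HasDerivAt (pot M a k ω Λ) (potSlope M a k ω Λ r / (r ^ 2 + a ^ 2) ^ 3) r := by
  have hnum : HasDerivAt (fun r : ℝ => 4 * M * r * k * ω - k ^ 2 + Delta M a r * Λ)
      (4 * M * k * ω + (2 * r - 2 * M) * Λ) r := by
    have hlin := (((hasDerivAt_id' r).const_mul (4 * M)).mul_const k).mul_const ω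
    have hDelta :=
      ((hasDerivAt_pow 2 r).sub ((hasDerivAt_id' r).const_mul (2 * M))).add_const (a ^ 2)
    exact ((hlin.sub_const (k ^ 2)).add (hDelta.mul_const Λ)).congr_deriv (by norm_num)
  have hden : HasDerivAt (fun r : ℝ => (r ^ 2 + a ^ 2) ^ 2) (2 * (r ^ 2 + a ^ 2) * (2 * r)) r :=
    (((hasDerivAt_pow 2 r).add_const (a ^ 2)).pow 2).congr_deriv (by norm_num)
  refine (hnum.div hden (by positivity)).congr_deriv ?_
  unfold potSlope cubic Delta
  field_simp
  ring

theorem V0'_eq_pot' (ha : a ≠ 0) (ω : ℝ) (m : ℤ) (Λ r : ℝ) :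
    V0' M a ω m Λ r = pot' M a (a * m) ω Λ r := by
  unfold V0' rStarDeriv pot'
  rw [V0_eq_pot, (hasDerivAt_pot ha _ _ _ _).deriv]
  field_simp

theorem Admissible.sq_le {ω Λ : ℝ} {m : ℤ} (h : Admissible a ω m Λ) : (a * m) ^ 2 ≤ a ^ 2 * Λ := by
  have hm : (m : ℝ) ^ 2 ≤ Λ := by
    rw [← sq_abs]
    nlinarith [h.1, abs_nonneg (m : ℝ)]
  rw [mul_pow]
  gcongr

theorem Admissible.nonneg {ω Λ : ℝ} {m : ℤ} (h : Admissible a ω m Λ) : 0 ≤ Λ :=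
  (abs_nonneg _).trans h.2

theorem Admissible.pos {ω Λ : ℝ} {m : ℤ} (h : Admissible a ω m Λ) (hm : m ≠ 0) : 0 < Λ := by
  have : 0 < |(m : ℝ)| := abs_pos.2 (Int.cast_ne_zero.2 hm)
  exact lt_of_lt_of_le (by positivity) h.1

theorem RatioIn.exists_eq_mul (ha : a ≠ 0) {I : Set ℝ} {ω : ℝ} {m : ℤ} (h : RatioIn a I ω m) :
    ∃ γ ∈ I, ω = γ * (a * m) := by
  have : (m : ℝ) ≠ 0 := Int.cast_ne_zero.2 h.1
  exact ⟨ω / (a * m), h.2, by field_simp⟩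

/-! ### The horizon -/

theorem mass_pos (haM : |a| < M) : 0 < M := (abs_nonneg a).trans_lt haM

theorem sq_lt_sq_mass (haM : |a| < M) : a ^ 2 < M ^ 2 := sq_lt_sq' (abs_lt.1 haM).1 (abs_lt.1 haM).2

theorem mass_lt_rPlus (haM : |a| < M) : M < rPlus M a :=
  lt_add_of_pos_right _ (Real.sqrt_pos.2 (sub_pos.2 (sq_lt_sq_mass haM)))

theorem rPlus_sq (haM : |a| < M) : rPlus M a ^ 2 = 2 * M * rPlus M a - a ^ 2 := by
  have := Real.sq_sqrt (sub_nonneg.2 (sq_lt_sq_mass haM).le)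
  unfold rPlus
  linear_combination this

theorem rPlus_pos (haM : |a| < M) : 0 < rPlus M a := (mass_pos haM).trans (mass_lt_rPlus haM)

theorem rPlus_lt (ha : a ≠ 0) (haM : |a| < M) : rPlus M a < 2 * M := by
  have : 0 < a ^ 2 := by positivity
  nlinarith [rPlus_sq haM, rPlus_pos haM]

theorem Delta_eq_mul (haM : |a| < M) (r : ℝ) :
    Delta M a r = (r - rPlus M a) * (r + rPlus M a - 2 * M) := by
  unfold Delta
  linear_combination rPlus_sq haM

theorem Delta_pos (haM : |a| < M) {r : ℝ} (hr : rPlus M a < r) : 0 < Delta M a r := by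
  rw [Delta_eq_mul haM]
  exact mul_pos (by linarith) (by linarith [mass_lt_rPlus haM])

theorem Delta_nonneg (haM : |a| < M) {r : ℝ} (hr : rPlus M a ≤ r) : 0 ≤ Delta M a r := by
  rw [Delta_eq_mul haM]
  exact mul_nonneg (by linarith) (by linarith [mass_lt_rPlus haM])

theorem gammaPlus_pos (haM : |a| < M) : 0 < gammaPlus M a := by
  have := rPlus_pos haM
  have := mass_pos haM
  unfold gammaPlus
  positivity

theorem inv_gammaPlus (haM : |a| < M) : (gammaPlus M a)⁻¹ = rPlus M a ^ 2 + a ^ 2 := by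
  rw [gammaPlus, inv_inv, rPlus_sq haM]
  ring

theorem gammaPlus_mul (haM : |a| < M) : gammaPlus M a * (rPlus M a ^ 2 + a ^ 2) = 1 := by
  rw [← inv_gammaPlus haM, mul_inv_cancel₀ (gammaPlus_pos haM).ne']

theorem two_mul_gammaPlus_lt (haM : |a| < M) : 2 * a ^ 2 * gammaPlus M a < 1 := by
  have : 2 * a ^ 2 < rPlus M a ^ 2 + a ^ 2 := by
    nlinarith [mass_lt_rPlus haM, sq_lt_sq_mass haM, mass_pos haM]
  nlinarith [gammaPlus_mul haM, gammaPlus_pos haM]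

theorem cubic_rPlus (haM : |a| < M) :
    cubic M a (rPlus M a) = 4 * M * rPlus M a * (rPlus M a - M) := by
  unfold cubic
  linear_combination (-2 * rPlus M a - 2 * M) * rPlus_sq haM

theorem cubic_secant (u v w : ℝ) :
    cubic M a v * (w - u) = cubic M a u * (w - v) + cubic M a w * (v - u)
      + (w - u) * (w - v) * (v - u) * (2 * (u + v + w - 3 * M)) := by
  unfold cubic
  ring

/-! ### Algebra of the potential -/

theorem mul_le_mul_sq_add_mul {k Λ X Y c : ℝ} (ha : a ≠ 0) (hk : k ^ 2 ≤ a ^ 2 * Λ) (hY : c ≤ Y)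
    (hX : c ≤ a ^ 2 * X + Y) : c * Λ ≤ X * k ^ 2 + Y * Λ := by
  have ha2 : 0 < a ^ 2 := by positivity
  have hleft : 0 ≤ (Y - c) * (a ^ 2 * Λ - k ^ 2) := mul_nonneg (by linarith) (by linarith)
  have hright : 0 ≤ (a ^ 2 * X + Y - c) * k ^ 2 := mul_nonneg (by linarith) (by positivity)
  have : 0 ≤ a ^ 2 * (X * k ^ 2 + Y * Λ - c * Λ) := by nlinarith
  linarith [nonneg_of_mul_nonneg_right this ha2]

theorem pot_sub_sq (ha : a ≠ 0) (k ω Λ r : ℝ) :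
    (r ^ 2 + a ^ 2) ^ 2 * (pot M a k ω Λ r - ω ^ 2) =
      -(ω * (r ^ 2 + a ^ 2) - k) ^ 2 + Delta M a r * (Λ - 2 * k * ω) := by
  unfold pot Delta
  field_simp
  ring

theorem pot'_neg_iff (ha : a ≠ 0) (haM : |a| < M) {k ω Λ r : ℝ} (hr : rPlus M a < r) :
    pot' M a k ω Λ r < 0 ↔ potSlope M a k ω Λ r < 0 := by
  rw [pot', div_lt_iff₀ (by positivity), zero_mul, ← not_le, ← not_le,
    mul_nonneg_iff_of_pos_left (Delta_pos haM hr)]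

theorem exists_potSlope_eq (ha : a ≠ 0) (k ω Λ : ℝ) {u v : ℝ} (huv : u < v) :
    ∃ s ∈ Ioo u v, potSlope M a k ω Λ s * (v - u) =
      (pot M a k ω Λ v - pot M a k ω Λ u) * (s ^ 2 + a ^ 2) ^ 3 := by
  obtain ⟨s, hs, h⟩ := exists_hasDerivAt_eq_slope (pot M a k ω Λ)
    (fun r => potSlope M a k ω Λ r / (r ^ 2 + a ^ 2) ^ 3) huv
    (fun r _ => (hasDerivAt_pot ha k ω Λ r).continuousAt.continuousWithinAt)
    (fun r _ => hasDerivAt_pot ha k ω Λ r)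
  have : 0 < v - u := sub_pos.2 huv
  refine ⟨s, hs, ?_⟩
  field_simp at h
  linarith

theorem exists_le_potSlope_mul (ha : a ≠ 0) {k ω Λ d u v : ℝ} (huv : u < v) (hd : 0 ≤ d)
    (h : d ≤ pot M a k ω Λ v - pot M a k ω Λ u) :
    ∃ s ∈ Ioo u v, (a ^ 2) ^ 3 * d ≤ potSlope M a k ω Λ s * (v - u) := by
  obtain ⟨s, hs, hse⟩ := exists_potSlope_eq (M := M) ha k ω Λ huv
  refine ⟨s, hs, ?_⟩
  rw [hse, mul_comm]
  gcongr
  exacts [hd.trans h, le_add_of_nonneg_left (sq_nonneg s)]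

theorem exists_potSlope_mul_le (ha : a ≠ 0) {k ω Λ d u v : ℝ} (huv : u < v) (hd : 0 ≤ d)
    (h : d ≤ pot M a k ω Λ u - pot M a k ω Λ v) :
    ∃ s ∈ Ioo u v, potSlope M a k ω Λ s * (v - u) ≤ -((a ^ 2) ^ 3 * d) := by
  obtain ⟨s, hs, hse⟩ := exists_potSlope_eq (M := M) ha k ω Λ huv
  refine ⟨s, hs, ?_⟩
  rw [hse, le_neg, ← neg_mul, neg_sub, mul_comm]
  gcongr
  exacts [hd.trans h, le_add_of_nonneg_left (sq_nonneg s)]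

theorem mul_sq_le {C k γ Λ : ℝ} (hk : k ^ 2 ≤ a ^ 2 * Λ) (hγ : γ ^ 2 ≤ C) :
    (γ * k) ^ 2 ≤ a ^ 2 * C * Λ := by
  have hC : 0 ≤ C := (sq_nonneg γ).trans hγ
  rw [mul_pow]
  calc γ ^ 2 * k ^ 2 ≤ C * (a ^ 2 * Λ) := by gcongr
    _ = a ^ 2 * C * Λ := by ring

theorem exists_mul_le_Delta_mul_div (haM : |a| < M) {c C ρ : ℝ} (hc : 0 < c) (hC : 0 ≤ C) :
    ∃ c₂ > 0, ∀ ω Λ r s : ℝ,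
      0 ≤ Λ → ω ^ 2 ≤ C * Λ → rPlus M a < r → r ≤ ρ → c * Λ ≤ s →
      c₂ * (Delta M a r * (r ^ 2)⁻¹ * (Λ + ω ^ 2)) ≤ Delta M a r * s / (r ^ 2 + a ^ 2) ^ 4 := by
  have hp := rPlus_pos haM
  refine ⟨c * rPlus M a ^ 2 / ((1 + C) * (rPlus M a ^ 2 + ρ ^ 2 + a ^ 2) ^ 4), by positivity,
    fun ω Λ r s hΛ hω hr hrρ hs => ?_⟩
  have hr0 : 0 < r := hp.trans hr
  have hD := Delta_pos haM hr
  have hden : (r ^ 2 + a ^ 2) ^ 4 ≤ (rPlus M a ^ 2 + ρ ^ 2 + a ^ 2) ^ 4 := by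
    apply pow_le_pow_left₀ (by positivity)
    nlinarith [sq_nonneg (rPlus M a)]
  have hweight : rPlus M a ^ 2 * (r ^ 2)⁻¹ ≤ 1 := by
    rw [← div_eq_mul_inv, div_le_one (by positivity)]
    nlinarith
  have hfreq : (Λ + ω ^ 2) / (1 + C) ≤ Λ := by
    rw [div_le_iff₀ (by positivity)]
    nlinarith
  have hs0 : 0 ≤ s := le_trans (by positivity) hs
  calc c * rPlus M a ^ 2 / ((1 + C) * (rPlus M a ^ 2 + ρ ^ 2 + a ^ 2) ^ 4)
        * (Delta M a r * (r ^ 2)⁻¹ * (Λ + ω ^ 2))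
      = Delta M a r * (c * ((rPlus M a ^ 2 * (r ^ 2)⁻¹) * ((Λ + ω ^ 2) / (1 + C))))
          / (rPlus M a ^ 2 + ρ ^ 2 + a ^ 2) ^ 4 := by field_simp
    _ ≤ Delta M a r * (c * (1 * Λ)) / (rPlus M a ^ 2 + ρ ^ 2 + a ^ 2) ^ 4 := by gcongr
    _ ≤ Delta M a r * s / (rPlus M a ^ 2 + ρ ^ 2 + a ^ 2) ^ 4 := by
        rw [one_mul]
        gcongr
    _ ≤ Delta M a r * s / (r ^ 2 + a ^ 2) ^ 4 := by gcongr

/-! ### Compactness -/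

theorem exists_eventually_forall_le {X Y : Type*} [TopologicalSpace X] [TopologicalSpace Y]
    {F : X → Y → ℝ} (hF : Continuous (Function.uncurry F)) {K : Set Y} (hK : IsCompact K) {x₀ : X}
    (h : ∀ y ∈ K, 0 < F x₀ y) : ∃ c > 0, ∀ᶠ x in 𝓝 x₀, ∀ y ∈ K, c ≤ F x y := by
  obtain ⟨c, hc, hcK⟩ := hK.exists_forall_le' (hF.uncurry_left x₀).continuousOn h
  refine ⟨c / 2, half_pos hc, hK.eventually_forall_of_forall_eventually fun y hy => ?_⟩
  have hlt : c / 2 < Function.uncurry F (x₀, y) := (half_lt_self hc).trans_le (hcK y hy)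
  exact (hF.continuousAt.eventually (lt_mem_nhds hlt)).mono fun _ => le_of_lt

theorem exists_Icc_eventually_forall_le {X : Type*} [TopologicalSpace X] {F : X → ℝ → ℝ}
    (hF : Continuous (Function.uncurry F)) {x₀ : X} {r l u : ℝ} (hr : r ∈ Ioo l u)
    (h : 0 < F x₀ r) :
    ∃ r₁ ∈ Ioo l r, ∃ r₂ ∈ Ioo r u, ∃ c > 0, ∀ᶠ x in 𝓝 x₀, ∀ s ∈ Icc r₁ r₂, c ≤ F x s := by
  have hev : ∀ᶠ s in 𝓝 r, 0 < F x₀ s ∧ s ∈ Ioo l u :=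
    ((hF.uncurry_left x₀).continuousAt.eventually (lt_mem_nhds h)).and (Ioo_mem_nhds hr.1 hr.2)
  obtain ⟨δ, hδ, hball⟩ := Metric.eventually_nhds_iff_ball.1 hev
  have hIcc : ∀ s ∈ Icc (r - δ / 2) (r + δ / 2), 0 < F x₀ s ∧ s ∈ Ioo l u := fun s hs => by
    apply hball
    rw [Real.ball_eq_Ioo]
    constructor <;> linarith [hs.1, hs.2]
  exact ⟨r - δ / 2, ⟨(hIcc _ ⟨le_rfl, by linarith⟩).2.1, by linarith⟩,
    r + δ / 2, ⟨by linarith, (hIcc _ ⟨by linarith, le_rfl⟩).2.2⟩,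
    exists_eventually_forall_le hF isCompact_Icc fun s hs => (hIcc s hs).1⟩

theorem eventually_mul_lt (A : ℝ) {B : ℝ} (hB : 0 < B) : ∀ᶠ c in 𝓝[>] (0 : ℝ), c * A < B := by
  have hlim : Tendsto (fun c : ℝ => c * A) (𝓝[>] 0) (𝓝 0) :=
    ((continuous_mul_const A).tendsto' 0 0 (zero_mul A)).mono_left nhdsWithin_le_nhds
  exact hlim.eventually_lt_const hB

theorem eventually_nhdsGT_zero_of_antitone {p : ℝ → Prop} (hp : ∀ ⦃c c'⦄, c ≤ c' → p c' → p c)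
    (h : ∃ c > 0, p c) : ∀ᶠ c in 𝓝[>] (0 : ℝ), p c := by
  obtain ⟨c₀, hc₀, h⟩ := h
  filter_upwards [Ioo_mem_nhdsGT hc₀] with c hc
  exact hp hc.2.le h

/-! ### Monotonicity near the horizon -/

/-- For `ω = γ k` the function `potSlope` is affine in `k² ∈ [0, a² Λ]`. This is its minimum over
that interval, divided by `Λ`. -/
def minSlope (M a γ r : ℝ) : ℝ :=
  min (cubic M a r) (a ^ 2 * (γ * (4 * M * a ^ 2 - 12 * M * r ^ 2) + 4 * r) + cubic M a r)

theorem continuous_minSlope : Continuous (Function.uncurry (minSlope M a)) := by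
  simp only [Function.uncurry_def, minSlope, cubic]
  fun_prop

theorem le_potSlope_of_le_minSlope (ha : a ≠ 0) {k Λ c γ r : ℝ} (hk : k ^ 2 ≤ a ^ 2 * Λ)
    (h : c ≤ minSlope M a γ r) : c * Λ ≤ potSlope M a k (γ * k) Λ r := by
  have := mul_le_mul_sq_add_mul ha hk (h.trans (min_le_left _ _)) (h.trans (min_le_right _ _))
  unfold potSlope
  linarith

theorem minSlope_le_of_le (haM : |a| < M) {γ γ' r : ℝ} (hγ : γ ≤ γ') (hr : rPlus M a ≤ r) :
    minSlope M a γ' r ≤ minSlope M a γ r := by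
  have hM := mass_pos haM
  have hneg : 4 * M * a ^ 2 - 12 * M * r ^ 2 ≤ 0 := by
    have : a ^ 2 ≤ r ^ 2 := by nlinarith [mass_lt_rPlus haM, sq_lt_sq_mass haM]
    nlinarith
  have := mul_le_mul_of_nonpos_right hγ hneg
  unfold minSlope
  gcongr

theorem minSlope_gammaPlus_rPlus_pos (haM : |a| < M) :
    0 < minSlope M a (gammaPlus M a) (rPlus M a) := by
  have hM := mass_pos haM
  have hp := rPlus_pos haM
  have hgap : 0 < rPlus M a - M := sub_pos.2 (mass_lt_rPlus haM)
  have hprod : 0 < M * rPlus M a - a ^ 2 := by nlinarith [sq_lt_sq_mass haM]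
  have hsq := rPlus_sq haM
  have hγ : gammaPlus M a * (2 * M * rPlus M a) = 1 := by
    rw [← gammaPlus_mul haM, hsq]
    ring
  have hvalue : a ^ 2 * (gammaPlus M a * (4 * M * a ^ 2 - 12 * M * rPlus M a ^ 2) + 4 * rPlus M a)
      + 4 * M * rPlus M a * (rPlus M a - M) = 4 * (rPlus M a - M) * (M * rPlus M a - a ^ 2) := by
    linear_combination (4 * M * gammaPlus M a * a ^ 2) * hsq
      + (4 * M - 8 * rPlus M a) * a ^ 2 * hγ
  rw [minSlope, lt_min_iff, cubic_rPlus haM, hvalue]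
  constructor <;> positivity

theorem exists_le_minSlope (haM : |a| < M) :
    ∃ ρ > rPlus M a, ∃ c > 0, ∀ᶠ ε in 𝓝[>] 0,
      ∀ γ ≤ gammaPlus M a + ε, ∀ r ∈ Icc (rPlus M a) ρ, c ≤ minSlope M a γ r := by
  obtain ⟨r₁, hr₁, ρ, hρ, c, hc, hev⟩ := exists_Icc_eventually_forall_le continuous_minSlope
    (show rPlus M a ∈ Ioo (rPlus M a - 1) (rPlus M a + 1) by constructor <;> linarith)
    (minSlope_gammaPlus_rPlus_pos haM)
  have hlim : Tendsto (fun ε => gammaPlus M a + ε) (𝓝[>] 0) (𝓝 (gammaPlus M a)) :=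
    ((continuous_const.add continuous_id).tendsto' 0 _ (add_zero _)).mono_left nhdsWithin_le_nhds
  refine ⟨ρ, hρ.1, c, hc, (hlim.eventually hev).mono fun ε hε γ hγ r hr => ?_⟩
  exact (hε r ⟨hr₁.2.le.trans hr.1, hr.2⟩).trans (minSlope_le_of_le haM hγ hr.1)

/-! ### Barriers -/

/-- The potential exceeds `ω²` by `c Λ` on `[r₁, r₂]`, increases at the horizon, and its slope
is concave beyond the horizon. Outside such a barrier, the part of the potential below `ω²` has no
critical point. -/
structure IsBarrier (M a c r₁ r₂ k ω Λ : ℝ) : Prop where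
  rPlus_lt : rPlus M a < r₁
  lt : r₁ < r₂
  freq_pos : 0 < Λ
  concave : 0 ≤ Λ * (rPlus M a - M) + 2 * M * (k * ω)
  le_slope : c * Λ ≤ potSlope M a k ω Λ (rPlus M a)
  le_pot : ∀ r ∈ Icc r₁ r₂, c * Λ ≤ pot M a k ω Λ r - ω ^ 2

namespace IsBarrier

variable {c r₁ r₂ k ω Λ : ℝ}

theorem secant_le (h : IsBarrier M a c r₁ r₂ k ω Λ) {v w : ℝ} (hv : rPlus M a < v) (hw : v < w) :
    potSlope M a k ω Λ (rPlus M a) * (w - v) + potSlope M a k ω Λ w * (v - rPlus M a)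
      ≤ potSlope M a k ω Λ v * (w - rPlus M a) := by
  have hsecant : potSlope M a k ω Λ v * (w - rPlus M a) =
      potSlope M a k ω Λ (rPlus M a) * (w - v) + potSlope M a k ω Λ w * (v - rPlus M a)
        + (w - rPlus M a) * (w - v) * (v - rPlus M a)
          * (2 * Λ * (rPlus M a + v + w - 3 * M) + 12 * M * (k * ω)) := by
    unfold potSlope cubic
    ring
  have hgaps : 0 ≤ (w - rPlus M a) * (w - v) * (v - rPlus M a) :=
    mul_nonneg (mul_nonneg (by linarith) (by linarith)) (by linarith)
  have hconcave : 0 ≤ 2 * Λ * (rPlus M a + v + w - 3 * M) + 12 * M * (k * ω) := by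
    nlinarith [h.concave, h.freq_pos]
  linarith [mul_nonneg hgaps hconcave]

theorem lt_or_lt_of_sub_le (h : IsBarrier M a c r₁ r₂ k ω Λ) (hc : 0 < c) {r : ℝ}
    (hV : pot M a k ω Λ r - ω ^ 2 ≤ c / 2 * Λ) : r < r₁ ∨ r₂ < r := by
  by_contra! hr
  linarith [h.le_pot r hr, mul_pos hc h.freq_pos]

theorem le_potSlope_of_lt (ha : a ≠ 0) (h : IsBarrier M a c r₁ r₂ k ω Λ) {c' r : ℝ} (hc : 0 < c)
    (hc' : c' ≤ c) (hr : rPlus M a < r) (hr₁ : r < r₁)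
    (hV : pot M a k ω Λ r - ω ^ 2 ≤ c / 2 * Λ) (hwidth : c' * (r₁ - r) ≤ (a ^ 2) ^ 3 * (c / 2)) :
    c' * Λ ≤ potSlope M a k ω Λ r := by
  have hΛ := h.freq_pos
  have hrise : c / 2 * Λ ≤ pot M a k ω Λ r₁ - pot M a k ω Λ r := by
    linarith [h.le_pot r₁ ⟨le_rfl, h.lt.le⟩]
  obtain ⟨s, hs, hmean⟩ := exists_le_potSlope_mul ha hr₁ (by positivity) hrise
  have hslope : c' * Λ ≤ potSlope M a k ω Λ s := by
    refine le_of_mul_le_mul_right ?_ (sub_pos.2 hr₁)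
    nlinarith
  have hhor := (mul_le_mul_of_nonneg_right hc' hΛ.le).trans h.le_slope
  refine le_of_mul_le_mul_right ?_ (show 0 < s - rPlus M a by linarith [hs.1])
  calc c' * Λ * (s - rPlus M a) = c' * Λ * (s - r) + c' * Λ * (r - rPlus M a) := by ring
    _ ≤ potSlope M a k ω Λ (rPlus M a) * (s - r) + potSlope M a k ω Λ s * (r - rPlus M a) := by
        gcongr
        exact (sub_pos.2 hs.1).le
    _ ≤ potSlope M a k ω Λ r * (s - rPlus M a) := h.secant_le hr hs.1

theorem potSlope_mul_le_of_lt (ha : a ≠ 0) (h : IsBarrier M a c r₁ r₂ k ω Λ) {r : ℝ} (hc : 0 < c)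
    (hr₂ : r₂ < r) (hV : pot M a k ω Λ r - ω ^ 2 ≤ c / 2 * Λ) :
    potSlope M a k ω Λ r * (r - r₂) ≤ -((a ^ 2) ^ 3 * (c / 2 * Λ)) := by
  have hΛ := h.freq_pos
  have hfall : c / 2 * Λ ≤ pot M a k ω Λ r₂ - pot M a k ω Λ r := by
    linarith [h.le_pot r₂ ⟨h.lt.le, le_rfl⟩]
  obtain ⟨s, hs, hmean⟩ := exists_potSlope_mul_le ha hr₂ (by positivity) hfall
  have hps : rPlus M a < s := by linarith [hs.1, h.rPlus_lt, h.lt]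
  have hneg : potSlope M a k ω Λ s < 0 := by
    have : 0 < (a ^ 2) ^ 3 * (c / 2 * Λ) := by positivity
    exact neg_of_mul_neg_left (by linarith) (sub_pos.2 hr₂).le
  have hle : potSlope M a k ω Λ r ≤ potSlope M a k ω Λ s := by
    refine le_of_mul_le_mul_right ?_ (sub_pos.2 hps)
    have hhor : 0 < potSlope M a k ω Λ (rPlus M a) := (mul_pos hc hΛ).trans_le h.le_slope
    nlinarith [h.secant_le hps hs.2, mul_pos hhor (sub_pos.2 hs.2),
      mul_pos (neg_pos.2 hneg) (sub_pos.2 hs.2)]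
  exact (mul_le_mul_of_nonneg_right hle (sub_pos.2 hr₂).le).trans hmean

end IsBarrier

/-- What the generalised superradiant ranges have to satisfy: where `V₀` does not exceed `ω²` by
more than `b ω²`, it increases to the left of `r₁` and decreases to the right of `r₂`, at a definite
rate as long as `r < 2 R`. -/
def SuperSlope (M a b R r₁ r₂ ω : ℝ) (m : ℤ) (Λ : ℝ) : Prop :=
  ∀ r, rPlus M a < r → V0 M a ω m Λ r - ω ^ 2 ≤ b * ω ^ 2 →
    (r < r₁ ∧ b * Delta M a r * (r ^ 2)⁻¹ * ω ^ 2 < V0' M a ω m Λ r) ∨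
    (r₂ < r ∧ V0' M a ω m Λ r < 0 ∧
      (r < 2 * R → V0' M a ω m Λ r < -(b * Delta M a r * (r ^ 2)⁻¹ * ω ^ 2)))

theorem eventually_superSlope (ha : a ≠ 0) (haM : |a| < M) {c C R : ℝ} (hc : 0 < c) (hC : 0 ≤ C)
    (hR : 0 < R) : ∀ᶠ b in 𝓝[>] 0, ∀ (r₁ r₂ ω : ℝ) (m : ℤ) (Λ : ℝ), r₂ < R → ω ^ 2 ≤ C * Λ →
      IsBarrier M a c r₁ r₂ (a * m) ω Λ → SuperSlope M a b R r₁ r₂ ω m Λ := by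
  obtain ⟨c', hc', hc'0⟩ : ∃ c', (c' ≤ c ∧ c' * (2 * R) ≤ (a ^ 2) ^ 3 * (c / 2)) ∧ 0 < c' := by
    refine ⟨min c ((a ^ 2) ^ 3 * (c / 2) / (2 * R)), ⟨min_le_left _ _, ?_⟩, by positivity⟩
    exact (le_div_iff₀ (by positivity)).1 (min_le_right _ _)
  obtain ⟨c₂, hc₂, hweight⟩ := exists_mul_le_Delta_mul_div haM (ρ := 2 * R) hc'0 hC
  filter_upwards [Ioo_mem_nhdsGT hc₂, Ioo_mem_nhdsGT (show 0 < c / 2 / (C + 1) by positivity)]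
    with b hb hb' r₁ r₂ ω m Λ hr₂ hω h r hr hV
  have hp := rPlus_pos haM
  have hΛ := h.freq_pos
  have hD := Delta_pos haM hr
  have hVΛ : V0 M a ω m Λ r - ω ^ 2 ≤ c / 2 * Λ := by
    have := (lt_div_iff₀ (by positivity)).1 hb'.2
    nlinarith [hb.1, mul_nonneg hb.1.le hΛ.le]
  have hstrict : b * Delta M a r * (r ^ 2)⁻¹ * ω ^ 2
      < c₂ * (Delta M a r * (r ^ 2)⁻¹ * (Λ + ω ^ 2)) := by
    have hw : 0 < Delta M a r * (r ^ 2)⁻¹ := mul_pos hD (by have := hp.trans hr; positivity)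
    nlinarith [mul_pos hc₂ (mul_pos hw hΛ), mul_nonneg hw.le (sq_nonneg ω), hb.2,
      mul_nonneg (sub_nonneg.2 hb.2.le) (mul_nonneg hw.le (sq_nonneg ω))]
  rw [V0_eq_pot] at hVΛ
  rw [V0'_eq_pot' ha]
  rcases h.lt_or_lt_of_sub_le hc hVΛ with hr₁ | hr₂r
  · have hslope := h.le_potSlope_of_lt ha hc hc'.1 hr hr₁ hVΛ (by nlinarith [h.lt])
    exact Or.inl ⟨hr₁, hstrict.trans_le (hweight ω Λ r _ hΛ.le hω hr (by linarith [h.lt]) hslope)⟩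
  · have hmean := h.potSlope_mul_le_of_lt ha hc hr₂r hVΛ
    have hneg : potSlope M a (a * m) ω Λ r < 0 := by
      have : 0 < (a ^ 2) ^ 3 * (c / 2 * Λ) := by positivity
      exact neg_of_mul_neg_left (by linarith) (sub_pos.2 hr₂r).le
    refine Or.inr ⟨hr₂r, (pot'_neg_iff ha haM hr).2 hneg, fun hr2R => ?_⟩
    have hslope : c' * Λ ≤ -potSlope M a (a * m) ω Λ r := by
      have hwidth : c' * (r - r₂) ≤ (a ^ 2) ^ 3 * (c / 2) :=
        (mul_le_mul_of_nonneg_left (by linarith [h.lt, h.rPlus_lt]) hc'0.le).trans hc'.2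
      refine le_of_mul_le_mul_right ?_ (sub_pos.2 hr₂r)
      nlinarith
    have hpot' := hweight ω Λ r _ hΛ.le hω hr hr2R.le hslope
    rw [mul_neg, neg_div] at hpot'
    exact lt_neg.1 (hstrict.trans_le hpot')

theorem exists_mul_le_V0'_of_le_minSlope (ha : a ≠ 0) (haM : |a| < M) {c C ρ : ℝ} (hc : 0 < c)
    (hC : 0 ≤ C) :
    ∃ c₂ > 0, ∀ (γ : ℝ) (m : ℤ) (Λ r : ℝ), Admissible a (γ * (a * m)) m Λ → γ ^ 2 ≤ C →
      r ∈ Ioc (rPlus M a) ρ → c ≤ minSlope M a γ r →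
      c₂ * (Delta M a r * (r ^ 2)⁻¹ * (Λ + (γ * (a * m)) ^ 2)) ≤ V0' M a (γ * (a * m)) m Λ r := by
  obtain ⟨c₂, hc₂, hweight⟩ := exists_mul_le_Delta_mul_div haM (C := a ^ 2 * C) (ρ := ρ) hc
    (by positivity)
  refine ⟨c₂, hc₂, fun γ m Λ r hadm hγ hr hmin => ?_⟩
  rw [V0'_eq_pot' ha]
  exact hweight _ _ _ _ hadm.nonneg (mul_sq_le hadm.sq_le hγ) hr.1 hr.2
    (le_potSlope_of_le_minSlope ha hadm.sq_le hmin)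

theorem exists_mul_le_V0'_near_horizon (ha : a ≠ 0) (haM : |a| < M) :
    ∃ ρ > rPlus M a, ∃ c > 0, ∀ᶠ ε in 𝓝[>] 0, ∀ (ω : ℝ) (m : ℤ) (Λ : ℝ),
      Admissible a ω m Λ → RatioIn a (genSuper M a ε) ω m → ∀ r ∈ Ioc (rPlus M a) ρ,
        c * (Delta M a r * (r ^ 2)⁻¹ * (Λ + ω ^ 2)) ≤ V0' M a ω m Λ r := by
  obtain ⟨ρ, hρ, c, hc, hev⟩ := exists_le_minSlope haM
  obtain ⟨c₂, hc₂, hslope⟩ := exists_mul_le_V0'_of_le_minSlope ha haM (ρ := ρ) hc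
    (sq_nonneg (gammaPlus M a + 1))
  refine ⟨ρ, hρ, c₂, hc₂, ?_⟩
  filter_upwards [hev, Ioo_mem_nhdsGT one_pos] with ε hmin hε ω m Λ hadm hI r hr
  obtain ⟨γ, hγ, rfl⟩ := hI.exists_eq_mul ha
  have hγ0 := gammaPlus_pos haM
  exact hslope γ m Λ r hadm (sq_le_sq' (by linarith [hγ.1, hε.2]) (by linarith [hγ.2, hε.2])) hr
    (hmin γ hγ.2.le r ⟨hr.1.le, hr.2⟩)

/-! ### Frequency ratios close to zero -/

theorem cubic_pos (ha : a ≠ 0) (haM : |a| < M) {r : ℝ} (hr : r ∈ Icc (rPlus M a) (2.1 * M)) :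
    0 < cubic M a r := by
  have hM := mass_pos haM
  have hp := rPlus_pos haM
  have hMp : 0 < rPlus M a - M := sub_pos.2 (mass_lt_rPlus haM)
  have hp2 : 0 < 2.1 * M - rPlus M a := by linarith [rPlus_lt ha haM]
  have hleft : 0 < cubic M a (rPlus M a) := by
    rw [cubic_rPlus haM]
    positivity
  have hright : 0 < cubic M a (2.1 * M) := by
    have : 0 < M * (M ^ 2 - a ^ 2) := mul_pos hM (sub_pos.2 (sq_lt_sq_mass haM))
    have : 0 < M ^ 3 := by positivity
    unfold cubic
    nlinarith
  have hconcave : 0 ≤ (2.1 * M - rPlus M a) * (2.1 * M - r) * (r - rPlus M a)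
      * (2 * (rPlus M a + r + 2.1 * M - 3 * M)) :=
    mul_nonneg (mul_nonneg (mul_nonneg hp2.le (by linarith [hr.2])) (by linarith [hr.1]))
      (by linarith [hr.1])
  refine pos_of_mul_pos_left ?_ hp2.le
  rcases hr.1.eq_or_lt with rfl | hr₁
  · positivity
  · linarith [cubic_secant (M := M) (a := a) (rPlus M a) r (2.1 * M),
      mul_nonneg hleft.le (sub_nonneg.2 hr.2), mul_pos hright (sub_pos.2 hr₁)]

theorem Delta_mul_inv_sq_mul_nonneg (haM : |a| < M) {ω Λ r : ℝ} {m : ℤ}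
    (hadm : Admissible a ω m Λ) (hr : rPlus M a ≤ r) :
    0 ≤ Delta M a r * (r ^ 2)⁻¹ * (Λ + ω ^ 2) := by
  have := Delta_nonneg haM hr
  have := hadm.nonneg
  positivity

theorem exists_mul_le_V0'_of_small_ratio (ha : a ≠ 0) (haM : |a| < M) :
    ∃ c > 0, ∀ᶠ ε in 𝓝[>] 0, ∀ (ω : ℝ) (m : ℤ) (Λ : ℝ),
      Admissible a ω m Λ → RatioIn a (Ioo (-ε) ε) ω m → ∀ r ∈ Ioc (rPlus M a) (2.1 * M),
        c * (Delta M a r * (r ^ 2)⁻¹ * (Λ + ω ^ 2)) ≤ V0' M a ω m Λ r := by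
  have hpos : ∀ r ∈ Icc (rPlus M a) (2.1 * M), 0 < minSlope M a 0 r := fun r hr => by
    have hcubic := cubic_pos ha haM hr
    have := (rPlus_pos haM).trans_le hr.1
    rw [minSlope, lt_min_iff, zero_mul, zero_add]
    exact ⟨hcubic, by positivity⟩
  obtain ⟨c, hc, hev⟩ := exists_eventually_forall_le continuous_minSlope isCompact_Icc hpos
  obtain ⟨δ, hδ, hball⟩ := Metric.eventually_nhds_iff_ball.1 hev
  obtain ⟨c₂, hc₂, hslope⟩ := exists_mul_le_V0'_of_le_minSlope ha haM (ρ := 2.1 * M) hc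
    (sq_nonneg δ)
  refine ⟨c₂, hc₂, ?_⟩
  filter_upwards [Ioo_mem_nhdsGT hδ] with ε hε ω m Λ hadm hI r hr
  obtain ⟨γ, hγ, rfl⟩ := hI.exists_eq_mul ha
  have hγδ : γ ∈ Ioo (0 - δ) (0 + δ) := ⟨by linarith [hγ.1, hε.2], by linarith [hγ.2, hε.2]⟩
  rw [← Real.ball_eq_Ioo] at hγδ
  have hsq : γ ^ 2 ≤ δ ^ 2 := sq_le_sq' (by linarith [hγ.1, hε.2]) (by linarith [hγ.2, hε.2])
  exact hslope γ m Λ r hadm hsq hr (hball γ hγδ r ⟨hr.1.le, hr.2⟩)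

theorem le_pot_of_small_ratio (ha : a ≠ 0) (haM : |a| < M) {ε γ k Λ r : ℝ} (hε : 0 ≤ ε)
    (hεa : ε * (4 * a ^ 2) < 1 / 1000) (hγ : -ε ≤ γ) (hΛ : 0 < Λ) (hk : k ^ 2 ≤ a ^ 2 * Λ)
    (hr : 2.01 * M ≤ r) : Λ / (1608 * r ^ 2) ≤ pot M a k (γ * k) Λ r := by
  have hM := mass_pos haM
  have haM2 := sq_lt_sq_mass haM
  have hr0 : 0 < r := by linarith
  have hnum : Λ * r ^ 2 / 402 ≤ 4 * M * r * k * (γ * k) - k ^ 2 + Delta M a r * Λ := by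
    have hγk : -(ε * (a ^ 2 * Λ)) ≤ γ * k ^ 2 := by
      calc -(ε * (a ^ 2 * Λ)) ≤ -(ε * k ^ 2) := by gcongr
        _ = -ε * k ^ 2 := by ring
        _ ≤ γ * k ^ 2 := by gcongr
    have hcross : 4 * M * r * (-(ε * (a ^ 2 * Λ))) ≤ 4 * M * r * (γ * k ^ 2) := by gcongr
    have hsmall : ε * (4 * a ^ 2) * (M * r * Λ) ≤ 1 / 1000 * (M * r * Λ) := by gcongr
    have hfar : 0 ≤ (r - 2.01 * M) * (r * Λ) := mul_nonneg (by linarith) (by positivity)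
    have : 0 < Λ * r ^ 2 := by positivity
    unfold Delta
    linarith
  have hden : (r ^ 2 + a ^ 2) ^ 2 ≤ (2 * r ^ 2) ^ 2 := by
    gcongr
    nlinarith
  calc Λ / (1608 * r ^ 2) = (Λ * r ^ 2 / 402) / (2 * r ^ 2) ^ 2 := by
        field_simp
        norm_num
    _ ≤ (Λ * r ^ 2 / 402) / (r ^ 2 + a ^ 2) ^ 2 := by gcongr
    _ ≤ pot M a k (γ * k) Λ r := by
        unfold pot
        gcongr

theorem eventually_mul_le_V0_of_small_ratio (ha : a ≠ 0) (haM : |a| < M) :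
    ∀ᶠ ε in 𝓝[>] 0, ∀ (ω : ℝ) (m : ℤ) (Λ : ℝ),
      Admissible a ω m Λ → RatioIn a (Ioo (-ε) ε) ω m → ∀ r ∈ Ici (2.01 * M),
        1 / 3216 * ((r ^ 2)⁻¹ * (Λ + ω ^ 2)) ≤ V0 M a ω m Λ r := by
  filter_upwards [eventually_mul_lt (4 * a ^ 2) (show 0 < 1 / 1000 by norm_num),
    eventually_mul_lt (a ^ 2) one_pos, Ioo_mem_nhdsGT one_pos]
    with ε hε hεa hε1 ω m Λ hadm hI r hr
  obtain ⟨γ, hγ, rfl⟩ := hI.exists_eq_mul ha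
  have hΛ := hadm.pos hI.1
  have hr0 : 0 < r := by linarith [mem_Ici.1 hr, mass_pos haM]
  have hω : (γ * (a * m)) ^ 2 ≤ Λ := by
    have hγε : γ ^ 2 ≤ ε := by nlinarith [hγ.1, hγ.2, hε1.2]
    nlinarith [hεa, mul_sq_le hadm.sq_le hγε]
  rw [V0_eq_pot]
  refine le_trans ?_ (le_pot_of_small_ratio ha haM hε1.1.le hε hγ.1.le hΛ hadm.sq_le hr)
  calc 1 / 3216 * ((r ^ 2)⁻¹ * (Λ + (γ * (a * m)) ^ 2)) ≤ 1 / 3216 * ((r ^ 2)⁻¹ * (Λ + Λ)) := by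
        gcongr
    _ = Λ / (1608 * r ^ 2) := by
        field_simp
        norm_num

theorem eventually_half_sq_lt_V0_of_small_ratio (ha : a ≠ 0) (haM : |a| < M) (R : ℝ) :
    ∀ᶠ ε in 𝓝[>] 0, ∀ (ω : ℝ) (m : ℤ) (Λ : ℝ),
      Admissible a ω m Λ → RatioIn a (Ioo (-ε) ε) ω m → ∀ r ∈ Icc (2.01 * M) R,
        1 / 2 * ω ^ 2 < V0 M a ω m Λ r := by
  filter_upwards [eventually_mul_lt (4 * a ^ 2) (show 0 < 1 / 1000 by norm_num),
    eventually_mul_lt (a ^ 2 * R ^ 2 * 804) one_pos, Ioo_mem_nhdsGT one_pos]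
    with ε hε hεR hε1 ω m Λ hadm hI r hr
  obtain ⟨γ, hγ, rfl⟩ := hI.exists_eq_mul ha
  have hΛ := hadm.pos hI.1
  have hr0 : 0 < r := by linarith [hr.1, mass_pos haM]
  have hγε : γ ^ 2 ≤ ε := by nlinarith [hγ.1, hγ.2, hε1.2]
  rw [V0_eq_pot]
  refine lt_of_lt_of_le ?_ (le_pot_of_small_ratio ha haM hε1.1.le hε hγ.1.le hΛ hadm.sq_le hr.1)
  rw [lt_div_iff₀ (by positivity)]
  calc 1 / 2 * (γ * (a * m)) ^ 2 * (1608 * r ^ 2)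
      ≤ 1 / 2 * (a ^ 2 * ε * Λ) * (1608 * R ^ 2) := by
        gcongr
        exacts [mul_nonneg (by norm_num) (mul_nonneg (mul_nonneg (sq_nonneg a) hε1.1.le) hΛ.le),
          mul_sq_le hadm.sq_le hγε, hr.2]
    _ = ε * (a ^ 2 * R ^ 2 * 804) * Λ := by ring
    _ < 1 * Λ := by gcongr
    _ = Λ := one_mul Λ

theorem exists_forall_eventually_small_ratio_bounds (ha : a ≠ 0) (haM : |a| < M) :
    ∃ c > 0, ∀ R, ∀ᶠ ε in 𝓝[>] 0, ∀ (ω : ℝ) (m : ℤ) (Λ : ℝ),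
      Admissible a ω m Λ → RatioIn a (Ioo (-ε) ε) ω m →
        (∀ r ∈ Ioc (rPlus M a) (2.1 * M),
          c * (Delta M a r * (r ^ 2)⁻¹ * (Λ + ω ^ 2)) ≤ V0' M a ω m Λ r) ∧
        (∀ r ∈ Ici (2.01 * M), c * ((r ^ 2)⁻¹ * (Λ + ω ^ 2)) ≤ V0 M a ω m Λ r) ∧
        (∀ r ∈ Icc (2.01 * M) R, 1 / 2 * ω ^ 2 < V0 M a ω m Λ r) := by
  obtain ⟨c, hc, hslope⟩ := exists_mul_le_V0'_of_small_ratio ha haM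
  refine ⟨min c (1 / 3216), by positivity, fun R => ?_⟩
  filter_upwards [hslope, eventually_mul_le_V0_of_small_ratio ha haM,
    eventually_half_sq_lt_V0_of_small_ratio ha haM R] with ε hslope hV hhalf ω m Λ hadm hω
  refine ⟨fun r hr => (hslope ω m Λ hadm hω r hr).trans' ?_,
    fun r hr => (hV ω m Λ hadm hω r hr).trans' ?_, hhalf ω m Λ hadm hω⟩
  · exact mul_le_mul_of_nonneg_right (min_le_left _ _)
      (Delta_mul_inv_sq_mul_nonneg haM hadm hr.1.le)
  · have := hadm.nonneg
    exact mul_le_mul_of_nonneg_right (min_le_right _ _) (by positivity)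

/-! ### Frequency ratios away from zero -/

theorem Delta_mul_le_mul_sq_add_pot (ha : a ≠ 0) (hM : 0 ≤ M) {c₁ c₂ R γ k Λ r : ℝ} (hr : 0 ≤ r)
    (hrR : r ≤ R) (hc₁ : 0 ≤ c₁) (hc₂ : 0 ≤ c₂) (hγk : -γ * k ^ 2 ≤ c₁ * (γ * k) ^ 2)
    (hk : k ^ 2 ≤ c₂ * (γ * k) ^ 2) (hpot : 0 ≤ pot M a k (γ * k) Λ r) :
    Delta M a r * Λ ≤
      ((R ^ 2 + a ^ 2) ^ 2 + 4 * M * R * c₁ + c₂) * ((γ * k) ^ 2 + pot M a k (γ * k) Λ r) := by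
  have hR : 0 ≤ R := hr.trans hrR
  calc Delta M a r * Λ
      = (r ^ 2 + a ^ 2) ^ 2 * pot M a k (γ * k) Λ r + 4 * M * r * (-γ * k ^ 2) + k ^ 2 := by
        unfold pot
        field_simp
        ring
    _ ≤ (R ^ 2 + a ^ 2) ^ 2 * pot M a k (γ * k) Λ r + 4 * M * R * (c₁ * (γ * k) ^ 2)
          + c₂ * (γ * k) ^ 2 := by
        have hcross : 4 * M * r * (-γ * k ^ 2) ≤ 4 * M * R * (c₁ * (γ * k) ^ 2) :=
          (mul_le_mul_of_nonneg_left hγk (by positivity)).trans (by gcongr)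
        gcongr
    _ = (R ^ 2 + a ^ 2) ^ 2 * pot M a k (γ * k) Λ r
          + (4 * M * R * c₁ + c₂) * (γ * k) ^ 2 := by ring
    _ ≤ ((R ^ 2 + a ^ 2) ^ 2 + 4 * M * R * c₁ + c₂)
          * ((γ * k) ^ 2 + pot M a k (γ * k) Λ r) := by
        have : 0 ≤ (R ^ 2 + a ^ 2) ^ 2 * (γ * k) ^ 2 := by positivity
        have : 0 ≤ (4 * M * R * c₁ + c₂) * pot M a k (γ * k) Λ r := by positivity
        linarith

theorem exists_mul_le_sq_add_V0 (ha : a ≠ 0) (haM : |a| < M) {γ₀ R : ℝ} (hγ₀ : 0 < γ₀)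
    (hR : 0 < R) : ∃ c > 0, ∀ (ω : ℝ) (m : ℤ) (Λ : ℝ), RatioIn a {γ | γ₀ ≤ |γ|} ω m →
      ∀ r ∈ Icc (rPlus M a) R, ω ^ 2 ≤ V0 M a ω m Λ r →
        c * (Delta M a r * Λ) ≤ ω ^ 2 + V0 M a ω m Λ r := by
  have hM := mass_pos haM
  refine ⟨((R ^ 2 + a ^ 2) ^ 2 + 4 * M * R * (1 / γ₀) + 1 / γ₀ ^ 2)⁻¹, by positivity,
    fun ω m Λ hI r hr hV => ?_⟩
  obtain ⟨γ, hγ, rfl⟩ := hI.exists_eq_mul ha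
  rw [V0_eq_pot] at *
  set k : ℝ := a * m
  have hγsq : γ₀ ^ 2 ≤ γ ^ 2 := sq_le_sq.2 (by rwa [abs_of_pos hγ₀])
  have hk : k ^ 2 ≤ 1 / γ₀ ^ 2 * (γ * k) ^ 2 := by
    rw [div_mul_eq_mul_div, le_div_iff₀ (by positivity), one_mul]
    nlinarith [mul_le_mul_of_nonneg_right hγsq (sq_nonneg k)]
  have hγk : -γ * k ^ 2 ≤ 1 / γ₀ * (γ * k) ^ 2 := by
    have : -γ * γ₀ ≤ γ ^ 2 := by
      rw [← sq_abs γ]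
      nlinarith [neg_le_abs γ, abs_nonneg γ, show γ₀ ≤ |γ| from hγ]
    rw [div_mul_eq_mul_div, le_div_iff₀ (by positivity), one_mul]
    nlinarith [sq_nonneg k]
  rw [inv_mul_le_iff₀ (by positivity)]
  exact Delta_mul_le_mul_sq_add_pot ha hM.le ((rPlus_pos haM).le.trans hr.1) hr.2 (by positivity)
    (by positivity) hγk hk ((sq_nonneg _).trans hV)

/-! ### The potential of a superradiant frequency exceeds `ω²` -/

/-- For `ω = γ k` the function `(r² + a²)² (V₀ - ω²)` is affine in `k² ∈ [0, a² Λ]`. This is its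
minimum over that interval, divided by `Λ`. -/
def superFun (M a γ r : ℝ) : ℝ :=
  min (Delta M a r) (a ^ 2 * (-(γ * (r ^ 2 + a ^ 2) - 1) ^ 2 - 2 * γ * Delta M a r) + Delta M a r)

theorem continuous_superFun : Continuous (Function.uncurry (superFun M a)) := by
  simp only [Function.uncurry_def, superFun, Delta]
  fun_prop

theorem mul_le_pot_sub_of_le_superFun (ha : a ≠ 0) {c γ k Λ r R : ℝ} (hc : 0 ≤ c) (hΛ : 0 ≤ Λ)
    (hk : k ^ 2 ≤ a ^ 2 * Λ) (hr : 0 ≤ r) (hrR : r ≤ R) (h : c ≤ superFun M a γ r) :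
    c / (R ^ 2 + a ^ 2) ^ 2 * Λ ≤ pot M a k (γ * k) Λ r - (γ * k) ^ 2 := by
  have hnum : c * Λ ≤ (r ^ 2 + a ^ 2) ^ 2 * (pot M a k (γ * k) Λ r - (γ * k) ^ 2) := by
    have := mul_le_mul_sq_add_mul ha hk (h.trans (min_le_left _ _)) (h.trans (min_le_right _ _))
    rw [pot_sub_sq ha]
    linarith
  calc c / (R ^ 2 + a ^ 2) ^ 2 * Λ = c * Λ / (R ^ 2 + a ^ 2) ^ 2 := by ring
    _ ≤ c * Λ / (r ^ 2 + a ^ 2) ^ 2 := by gcongr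
    _ ≤ pot M a k (γ * k) Λ r - (γ * k) ^ 2 := by
        rw [div_le_iff₀ (by positivity), mul_comm _ ((r ^ 2 + a ^ 2) ^ 2)]
        exact hnum

theorem superFun_five_mul_pos (ha : a ≠ 0) (haM : |a| < M) {γ : ℝ} (hγ : 0 ≤ γ)
    (h : γ * ((5 * M) ^ 2 + a ^ 2) ≤ 1) : 0 < superFun M a γ (5 * M) := by
  have hM := mass_pos haM
  have haM2 := sq_lt_sq_mass haM
  have ha2 : 0 < a ^ 2 := by positivity
  have hD : Delta M a (5 * M) = 15 * M ^ 2 + a ^ 2 := by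
    unfold Delta
    ring
  have hsq : (γ * ((5 * M) ^ 2 + a ^ 2) - 1) ^ 2 ≤ 1 := by
    have : 0 ≤ γ * ((5 * M) ^ 2 + a ^ 2) := by positivity
    nlinarith
  have hlin : 2 * γ * (15 * M ^ 2 + a ^ 2) ≤ 2 := by nlinarith
  rw [superFun, lt_min_iff, hD]
  exact ⟨by positivity, by nlinarith⟩

theorem superFun_pos_of_mul_eq_one (haM : |a| < M) {γ r : ℝ} (hr : rPlus M a < r)
    (hγ : γ ≤ gammaPlus M a) (h : γ * (r ^ 2 + a ^ 2) = 1) : 0 < superFun M a γ r := by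
  have hD := Delta_pos haM hr
  have hγ2 : 2 * a ^ 2 * γ < 1 :=
    (mul_le_mul_of_nonneg_left hγ (by positivity)).trans_lt (two_mul_gammaPlus_lt haM)
  rw [superFun, lt_min_iff, h]
  exact ⟨hD, by nlinarith [mul_pos hD (sub_pos.2 hγ2)]⟩

theorem eventually_superFun_gammaPlus_pos (haM : |a| < M) :
    ∀ᶠ r in 𝓝[>] rPlus M a, 0 < superFun M a (gammaPlus M a) r := by
  set γ := gammaPlus M a
  set p := rPlus M a
  let quotient : ℝ → ℝ := fun r =>
    (r + p - 2 * M) * (1 - 2 * a ^ 2 * γ) - a ^ 2 * γ ^ 2 * (r - p) * (r + p) ^ 2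
  have hcont : Continuous quotient := by fun_prop
  have hp : 0 < quotient p := by
    have : 0 < (p + p - 2 * M) * (1 - 2 * a ^ 2 * γ) :=
      mul_pos (by linarith [mass_lt_rPlus haM]) (by linarith [two_mul_gammaPlus_lt haM])
    simpa [quotient] using this
  have hev : ∀ᶠ r in 𝓝[>] p, 0 < quotient r :=
    (hcont.continuousAt.eventually (lt_mem_nhds hp)).filter_mono nhdsWithin_le_nhds
  filter_upwards [hev, self_mem_nhdsWithin] with r hq hr
  have hroot : γ * (r ^ 2 + a ^ 2) - 1 = γ * (r - p) * (r + p) := by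
    linear_combination gammaPlus_mul haM
  have hmin : 0 < a ^ 2 * (-(γ * (r - p) * (r + p)) ^ 2 - 2 * γ * ((r - p) * (r + p - 2 * M)))
      + (r - p) * (r + p - 2 * M) := by
    linarith [mul_pos (sub_pos.2 (mem_Ioi.1 hr)) hq]
  rw [superFun, lt_min_iff, hroot]
  refine ⟨Delta_pos haM hr, ?_⟩
  rwa [Delta_eq_mul haM]

theorem exists_superFun_pos (ha : a ≠ 0) (haM : |a| < M) {γ : ℝ} (hγ : γ ∈ Icc 0 (gammaPlus M a)) :
    ∃ ρ ∈ Ioc (rPlus M a) (5 * M), 0 < superFun M a γ ρ := by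
  have hp5 : rPlus M a < 5 * M := by linarith [rPlus_lt ha haM, mass_pos haM]
  rcases hγ.2.eq_or_lt with rfl | hlt
  · obtain ⟨ρ, hpos, hρ⟩ :=
      ((eventually_superFun_gammaPlus_pos haM).and (Ioc_mem_nhdsGT hp5)).exists
    exact ⟨ρ, hρ, hpos⟩
  rcases le_or_gt (γ * ((5 * M) ^ 2 + a ^ 2)) 1 with h5 | h5
  · exact ⟨5 * M, ⟨hp5, le_rfl⟩, superFun_five_mul_pos ha haM hγ.1 h5⟩
  · have hhor : γ * (rPlus M a ^ 2 + a ^ 2) < 1 := by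
      rw [← gammaPlus_mul haM]
      gcongr
    have hcont : ContinuousOn (fun r : ℝ => γ * (r ^ 2 + a ^ 2)) (Icc (rPlus M a) (5 * M)) := by
      fun_prop
    obtain ⟨ρ, hρ, hone⟩ := intermediate_value_Ioo hp5.le hcont ⟨hhor, h5⟩
    exact ⟨ρ, ⟨hρ.1, hρ.2.le⟩, superFun_pos_of_mul_eq_one haM hρ.1 hγ.2 hone⟩

theorem eventually_exists_superFun_pos (ha : a ≠ 0) (haM : |a| < M) :
    ∀ᶠ l in 𝓝 (rPlus M a), ∀ γ ∈ Icc 0 (gammaPlus M a), ∃ ρ ∈ Ioc l (5 * M),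
      0 < superFun M a γ ρ := by
  refine isCompact_Icc.eventually_forall_of_forall_eventually fun γ hγ => ?_
  obtain ⟨ρ, hρ, hpos⟩ := exists_superFun_pos ha haM hγ
  have hcont : Continuous fun γ => superFun M a γ ρ := continuous_superFun.uncurry_right ρ
  rw [nhds_prod_eq]
  filter_upwards [(gt_mem_nhds hρ.1).prod_mk (hcont.continuousAt.eventually (lt_mem_nhds hpos))]
    with z hz
  exact ⟨ρ, ⟨hz.1, hρ.2⟩, hz.2⟩

theorem isBarrier_of_le_superFun (ha : a ≠ 0) (haM : |a| < M) {c₁ c₂ r₁ r₂ R γ k Λ : ℝ}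
    (hc₂ : 0 ≤ c₂) (hr₁ : rPlus M a < r₁) (hr : r₁ < r₂) (hR : r₂ ≤ R) (hΛ : 0 < Λ)
    (hk : k ^ 2 ≤ a ^ 2 * Λ) (hγ : -γ * (2 * M * a ^ 2) ≤ rPlus M a - M)
    (hslope : c₁ ≤ minSlope M a γ (rPlus M a)) (hpot : ∀ r ∈ Icc r₁ r₂, c₂ ≤ superFun M a γ r) :
    IsBarrier M a (min c₁ (c₂ / (R ^ 2 + a ^ 2) ^ 2)) r₁ r₂ k (γ * k) Λ where
  rPlus_lt := hr₁
  lt := hr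
  freq_pos := hΛ
  concave := by
    have := mul_le_mul_sq_add_mul (c := 0) (X := 2 * M * γ) ha hk
      (sub_pos.2 (mass_lt_rPlus haM)).le (by linarith)
    linarith
  le_slope := by
    refine (mul_le_mul_of_nonneg_right (min_le_left _ _) hΛ.le).trans ?_
    exact le_potSlope_of_le_minSlope ha hk hslope
  le_pot r hr := by
    refine (mul_le_mul_of_nonneg_right (min_le_right _ _) hΛ.le).trans ?_
    exact mul_le_pot_sub_of_le_superFun ha hc₂ hΛ.le hk
      ((rPlus_pos haM).trans (hr₁.trans_le hr.1)).le (hr.2.trans hR) (hpot r hr)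

/-! ### Trapping at non-superradiant frequencies -/

/-- For `k = t ω` and `V₀ = ω²`, the slope of `V₀` has the sign of `(r² + a² - t) trapFun`. The zero
of `trapFun` in `(r₊, ∞)` is the trapped radius. -/
def trapFun (M a t r : ℝ) : ℝ := cubic M a r - 2 * (r - M) * t

theorem Delta_mul_potSlope (ha : a ≠ 0) (t ω Λ r : ℝ) :
    Delta M a r * potSlope M a (t * ω) ω Λ r =
      (r ^ 2 + a ^ 2) * ω ^ 2 * ((r ^ 2 + a ^ 2 - t) * trapFun M a t r)
        + cubic M a r * ((r ^ 2 + a ^ 2) ^ 2 * (pot M a (t * ω) ω Λ r - ω ^ 2)) := by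
  rw [pot_sub_sq ha]
  unfold trapFun potSlope cubic Delta
  ring

theorem le_mul_Delta_mul_potSlope (ha : a ≠ 0) {b c t ω Λ r G σ : ℝ} (hσ : |σ| = 1)
    (hc : c ≤ σ * ((r ^ 2 + a ^ 2 - t) * trapFun M a t r)) (hG : |cubic M a r| ≤ G)
    (hV : |pot M a (t * ω) ω Λ r - ω ^ 2| < b * ω ^ 2) :
    (r ^ 2 + a ^ 2) * ω ^ 2 * (c - b * (G * (r ^ 2 + a ^ 2)))
      ≤ σ * (Delta M a r * potSlope M a (t * ω) ω Λ r) := by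
  have herror : -(G * ((r ^ 2 + a ^ 2) ^ 2 * (b * ω ^ 2))) ≤
      σ * (cubic M a r * ((r ^ 2 + a ^ 2) ^ 2 * (pot M a (t * ω) ω Λ r - ω ^ 2))) := by
    apply neg_le_of_abs_le
    rw [abs_mul, abs_mul, abs_mul, hσ, one_mul, abs_of_nonneg (sq_nonneg (r ^ 2 + a ^ 2))]
    have : 0 ≤ G := (abs_nonneg _).trans hG
    gcongr
  have hmain := mul_le_mul_of_nonneg_left hc (show 0 ≤ (r ^ 2 + a ^ 2) * ω ^ 2 by positivity)
  rw [Delta_mul_potSlope ha, mul_add]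
  linarith

theorem eventually_mul_le_mul_pot' (ha : a ≠ 0) (haM : |a| < M) {c R : ℝ} (hc : 0 < c) :
    ∀ᶠ b in 𝓝[>] 0, ∀ t ω Λ r σ : ℝ, |σ| = 1 → rPlus M a < r → r ≤ R →
      c ≤ σ * ((r ^ 2 + a ^ 2 - t) * trapFun M a t r) →
      |pot M a (t * ω) ω Λ r - ω ^ 2| < b * ω ^ 2 →
      b * Delta M a r * (r ^ 2)⁻¹ * ω ^ 2 ≤ σ * pot' M a (t * ω) ω Λ r := by
  have hM := mass_pos haM
  have hp := rPlus_pos haM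
  obtain ⟨G, hG⟩ := isCompact_Icc (a := rPlus M a) (b := R) |>.exists_bound_of_continuousOn
    (f := cubic M a) (by unfold cubic; fun_prop)
  filter_upwards [self_mem_nhdsWithin, eventually_mul_lt (G * (R ^ 2 + a ^ 2)) (half_pos hc),
    eventually_mul_lt ((R ^ 2 + a ^ 2) ^ 4 / rPlus M a ^ 2) (half_pos hc)]
    with b (hb : 0 < b) hbG hbR t ω Λ r σ hσ hr hrR hq hV
  have hr0 : 0 < r := hp.trans hr
  have hGr : |cubic M a r| ≤ G := hG r ⟨hr.le, hrR⟩
  have hG0 : 0 ≤ G := (abs_nonneg _).trans hGr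
  have hDelta : Delta M a r ≤ r ^ 2 + a ^ 2 := by
    unfold Delta
    nlinarith
  have hslope : (r ^ 2 + a ^ 2) * ω ^ 2 * (c / 2)
      ≤ σ * (Delta M a r * potSlope M a (t * ω) ω Λ r) := by
    refine le_trans ?_ (le_mul_Delta_mul_potSlope ha hσ hq hGr hV)
    gcongr
    have : b * (G * (r ^ 2 + a ^ 2)) ≤ b * (G * (R ^ 2 + a ^ 2)) := by gcongr
    linarith
  rw [pot', ← mul_div_assoc σ, le_div_iff₀ (by positivity)]
  calc b * Delta M a r * (r ^ 2)⁻¹ * ω ^ 2 * (r ^ 2 + a ^ 2) ^ 4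
      ≤ b * (r ^ 2 + a ^ 2) * (rPlus M a ^ 2)⁻¹ * ω ^ 2 * (R ^ 2 + a ^ 2) ^ 4 := by
        have := Delta_pos haM hr
        gcongr
    _ = (r ^ 2 + a ^ 2) * ω ^ 2 * (b * ((R ^ 2 + a ^ 2) ^ 4 / rPlus M a ^ 2)) := by ring
    _ ≤ (r ^ 2 + a ^ 2) * ω ^ 2 * (c / 2) := by gcongr
    _ ≤ σ * (Delta M a r * potSlope M a (t * ω) ω Λ r) := hslope

theorem pot_le (ha : a ≠ 0) (haM : |a| < M) {k ω Λ r : ℝ} (hr : rPlus M a < r)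
    (hΛ : |k * ω| ≤ Λ) : pot M a k ω Λ r ≤ 3 / a ^ 2 * Λ := by
  have hM := mass_pos haM
  have hp := mass_lt_rPlus haM
  have hr0 : 0 < r := by linarith
  have hΛ0 : 0 ≤ Λ := (abs_nonneg _).trans hΛ
  have hcross : 4 * M * r * (k * ω) ≤ 4 * M * r * Λ :=
    mul_le_mul_of_nonneg_left ((le_abs_self _).trans hΛ) (by positivity)
  have hcoeff : 4 * M * r + Delta M a r ≤ 3 * (r ^ 2 + a ^ 2) := by
    unfold Delta
    nlinarith [sq_nonneg a]
  have hden : 1 ≤ (r ^ 2 + a ^ 2) / a ^ 2 := by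
    rw [one_le_div (by positivity)]
    nlinarith
  unfold pot
  rw [div_le_iff₀ (by positivity)]
  calc 4 * M * r * k * ω - k ^ 2 + Delta M a r * Λ ≤ (4 * M * r + Delta M a r) * Λ := by
        nlinarith [sq_nonneg k]
    _ ≤ 3 * (r ^ 2 + a ^ 2) * Λ * 1 := by
        rw [mul_one]
        gcongr
    _ ≤ 3 * (r ^ 2 + a ^ 2) * Λ * ((r ^ 2 + a ^ 2) / a ^ 2) := by gcongr
    _ = 3 / a ^ 2 * Λ * (r ^ 2 + a ^ 2) ^ 2 := by ring

theorem potSlope_le_of_far (haM : |a| < M) {k ω Λ r : ℝ} (hk : k ^ 2 ≤ a ^ 2 * Λ)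
    (hΛ : |k * ω| ≤ Λ) (hr : 10 * M ≤ r) : potSlope M a k ω Λ r ≤ -(M ^ 3 * Λ) := by
  have hM := mass_pos haM
  have hr0 : 0 < r := by linarith
  have haM2 := sq_lt_sq_mass haM
  have hΛ0 : 0 ≤ Λ := (abs_nonneg _).trans hΛ
  have hcross : k * ω * (4 * M * a ^ 2 - 12 * M * r ^ 2) ≤ Λ * (12 * M * r ^ 2) := by
    have hcoeff : |4 * M * a ^ 2 - 12 * M * r ^ 2| ≤ 12 * M * r ^ 2 := by
      have : a ^ 2 ≤ r ^ 2 := by nlinarith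
      have := mul_le_mul_of_nonneg_left this hM.le
      have : 0 ≤ M * a ^ 2 := by positivity
      rw [abs_le]
      constructor <;> linarith
    refine (le_abs_self _).trans ?_
    rw [abs_mul]
    exact mul_le_mul hΛ hcoeff (abs_nonneg _) hΛ0
  have hsq : 4 * r * k ^ 2 ≤ 4 * r * (a ^ 2 * Λ) := by gcongr
  have hcubic : cubic M a r + 12 * M * r ^ 2 + 4 * r * a ^ 2 ≤ -M ^ 3 := by
    have : r * a ^ 2 ≤ r * M ^ 2 := by gcongr
    have : 0 ≤ M * a ^ 2 := by positivity
    have : 0 ≤ (r - 10 * M) * r ^ 2 := mul_nonneg (by linarith) (by positivity)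
    have : 0 ≤ (r - 10 * M) * (M * r) := mul_nonneg (by linarith) (by positivity)
    have : 0 ≤ (r - 10 * M) * M ^ 2 := mul_nonneg (by linarith) (by positivity)
    have : 0 < M ^ 3 := by positivity
    unfold cubic
    linarith
  have := mul_le_mul_of_nonneg_right hcubic hΛ0
  unfold potSlope
  linarith

/-- For frequencies with `k = t ω` the radii where `V₀ = ω²` and `V₀' ≤ 0` (respectively `V₀' ≥ 0`)
stay away from `(r₊, r₁]` (respectively `[r₂, ∞)`), quantitatively with margin `c`. -/
structure TrapSep (M a c t r₁ r₂ : ℝ) : Prop where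
  left : ∀ r, rPlus M a < r → r ≤ r₁ + c →
    (c ≤ r ^ 2 + a ^ 2 - t ∧ c ≤ trapFun M a t r) ∨ (t ≠ 0 ∧ c ≤ minSlope M a t⁻¹ r)
  right : ∀ r, rPlus M a < r → r₂ - c ≤ r → r ≤ 10 * M →
    c ≤ r ^ 2 + a ^ 2 - t ∧ trapFun M a t r ≤ -c

theorem TrapSep.mono {c c' t r₁ r₂ : ℝ} (h : TrapSep M a c t r₁ r₂) (hc : c' ≤ c) :
    TrapSep M a c' t r₁ r₂ where
  left r hr hr₁ := (h.left r hr (by linarith)).imp (fun h => ⟨hc.trans h.1, hc.trans h.2⟩)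
    fun h => ⟨h.1, hc.trans h.2⟩
  right r hr hr₂ hr₃ :=
    have h := h.right r hr (by linarith) hr₃
    ⟨hc.trans h.1, h.2.trans (neg_le_neg hc)⟩

theorem TrapSep.eventually_mul_le_pot' (ha : a ≠ 0) (haM : |a| < M) {c C R : ℝ} (hc : 0 < c)
    (hC : 0 ≤ C) : ∀ᶠ b in 𝓝[>] 0, ∀ t r₁ r₂ ω Λ r : ℝ, TrapSep M a c t r₁ r₂ →
      (t * ω) ^ 2 ≤ a ^ 2 * Λ → 0 ≤ Λ → ω ^ 2 ≤ C * Λ → rPlus M a < r → r ≤ r₁ + c → r ≤ R →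
      |pot M a (t * ω) ω Λ r - ω ^ 2| < b * ω ^ 2 →
      b * Delta M a r * (r ^ 2)⁻¹ * ω ^ 2 ≤ pot' M a (t * ω) ω Λ r := by
  obtain ⟨c₂, hc₂, hweight⟩ := exists_mul_le_Delta_mul_div (ρ := R) haM hc hC
  filter_upwards [eventually_mul_le_mul_pot' (R := R) ha haM (mul_pos hc hc), Ioo_mem_nhdsGT hc₂]
    with b htrap hb t r₁ r₂ ω Λ r hsep hk hΛ hω hr hr₁ hrR hV
  rcases hsep.left r hr hr₁ with ⟨hroot, htrapFun⟩ | ⟨ht, hmin⟩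
  · have := htrap t ω Λ r 1 abs_one hr hrR
      (by rw [one_mul]; exact mul_le_mul hroot htrapFun hc.le (hc.le.trans hroot)) hV
    rwa [one_mul] at this
  · have hslope := le_potSlope_of_le_minSlope ha hk hmin
    rw [inv_mul_cancel_left₀ ht] at hslope
    refine le_trans ?_ (hweight ω Λ r _ hΛ hω hr hrR hslope)
    have hD := Delta_pos haM hr
    calc b * Delta M a r * (r ^ 2)⁻¹ * ω ^ 2
        = b * (Delta M a r * (r ^ 2)⁻¹ * (0 + ω ^ 2)) := by ring
      _ ≤ c₂ * (Delta M a r * (r ^ 2)⁻¹ * (Λ + ω ^ 2)) := by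
          gcongr
          exact hb.2.le

theorem TrapSep.eventually_pot'_le (ha : a ≠ 0) (haM : |a| < M) {c C R : ℝ} (hc : 0 < c)
    (hC : 0 ≤ C) (hR : 10 * M ≤ R) :
    ∀ᶠ b in 𝓝[>] 0, ∀ t r₁ r₂ ω Λ r : ℝ, TrapSep M a c t r₁ r₂ →
      (t * ω) ^ 2 ≤ a ^ 2 * Λ → |t * ω * ω| ≤ Λ → ω ^ 2 ≤ C * Λ → ω ≠ 0 → rPlus M a < r →
      r₂ - c ≤ r → |pot M a (t * ω) ω Λ r - ω ^ 2| < b * ω ^ 2 →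
      pot' M a (t * ω) ω Λ r < 0 ∧
        (r ≤ R → pot' M a (t * ω) ω Λ r ≤ -(b * Delta M a r * (r ^ 2)⁻¹ * ω ^ 2)) := by
  have hM := mass_pos haM
  obtain ⟨c₂, hc₂, hweight⟩ := exists_mul_le_Delta_mul_div (ρ := R) haM (pow_pos hM 3) hC
  filter_upwards [eventually_mul_le_mul_pot' (R := R) ha haM (mul_pos hc hc), Ioo_mem_nhdsGT hc₂]
    with b htrap hb t r₁ r₂ ω Λ r hsep hk hΛ hω hω0 hr hr₂ hV
  have hD := Delta_pos haM hr
  have hr0 : 0 < r := (rPlus_pos haM).trans hr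
  have hb0 := hb.1
  have hΛ0 : 0 < Λ := pos_of_mul_pos_right ((by positivity : 0 < ω ^ 2).trans_le hω) hC
  rcases le_total r (10 * M) with h10 | h10
  · obtain ⟨hroot, htrapFun⟩ := hsep.right r hr hr₂ h10
    have hrate := htrap t ω Λ r (-1) (by simp) hr (h10.trans hR) (by
      have := mul_le_mul hroot (le_neg.1 htrapFun) hc.le (hc.le.trans hroot)
      linarith) hV
    have : 0 < b * Delta M a r * (r ^ 2)⁻¹ * ω ^ 2 := by positivity
    exact ⟨by linarith, fun _ => by linarith⟩
  · have hfar := potSlope_le_of_far haM hk hΛ h10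
    have : 0 < M ^ 3 * Λ := by positivity
    refine ⟨(pot'_neg_iff ha haM hr).2 (by linarith), fun hrR => ?_⟩
    have hrate := hweight ω Λ r _ hΛ0.le hω hr hrR (le_neg.1 hfar)
    rw [mul_neg, neg_div] at hrate
    refine le_neg.1 (le_trans ?_ hrate)
    calc b * Delta M a r * (r ^ 2)⁻¹ * ω ^ 2
        = b * (Delta M a r * (r ^ 2)⁻¹ * (0 + ω ^ 2)) := by ring
      _ ≤ c₂ * (Delta M a r * (r ^ 2)⁻¹ * (Λ + ω ^ 2)) := by
          gcongr
          exact hb.2.le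

/-- What the non-superradiant ranges have to satisfy: where `V₀` differs from `ω²` by less than
`b ω²`, it increases up to `r₁ + b` and decreases from `r₂ - b` on, at a definite rate as long as
`r < 2 R`. -/
def NonsuperSlope (M a b R r₁ r₂ ω : ℝ) (m : ℤ) (Λ : ℝ) : Prop :=
  ∀ r, rPlus M a < r → |V0 M a ω m Λ r - ω ^ 2| < b * ω ^ 2 →
    (r ≤ r₁ + b → b * Delta M a r * (r ^ 2)⁻¹ * ω ^ 2 ≤ V0' M a ω m Λ r) ∧
    (r₂ - b ≤ r → V0' M a ω m Λ r < 0 ∧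
      (r < 2 * R → V0' M a ω m Λ r ≤ -(b * Delta M a r * (r ^ 2)⁻¹ * ω ^ 2)))

theorem eventually_nonsuperSlope (ha : a ≠ 0) (haM : |a| < M) {c R : ℝ} (hc : 0 < c)
    (hR : 5 * M ≤ R) : ∀ᶠ b in 𝓝[>] 0, ∀ (t r₁ r₂ ω : ℝ) (m : ℤ) (Λ : ℝ), r₁ < R →
      TrapSep M a c t r₁ r₂ → a * m = t * ω → Admissible a ω m Λ →
      NonsuperSlope M a b R r₁ r₂ ω m Λ := by
  have hM := mass_pos haM
  have hC : 0 ≤ 6 / a ^ 2 := by positivity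
  filter_upwards [TrapSep.eventually_mul_le_pot' (R := 2 * R) ha haM hc hC,
    TrapSep.eventually_pot'_le (R := 2 * R) ha haM hc hC (by linarith), Ioo_mem_nhdsGT hc,
    Ioo_mem_nhdsGT (show 0 < R by linarith), Ioo_mem_nhdsGT one_half_pos]
    with b hleft hright hbc hbR hb t r₁ r₂ ω m Λ hr₁ hsep hkω hadm r hr hV
  have hω0 : ω ≠ 0 := by
    rintro rfl
    simpa using (abs_nonneg _).trans_lt hV
  have hk := hadm.sq_le
  have hΛ := hadm.2
  rw [V0_eq_pot] at hV
  rw [V0'_eq_pot' ha]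
  rw [hkω] at *
  have hω : ω ^ 2 ≤ 6 / a ^ 2 * Λ := by
    have hpot := pot_le ha haM hr hΛ
    have := mul_le_mul_of_nonneg_right hb.2.le (sq_nonneg ω)
    linarith [(abs_lt.1 hV).1, show 6 / a ^ 2 * Λ = 2 * (3 / a ^ 2 * Λ) by ring]
  refine ⟨fun hr₁' => ?_, fun hr₂ => ?_⟩
  · exact hleft t r₁ r₂ ω Λ r hsep hk hadm.nonneg hω hr (by linarith [hbc.2])
      (by linarith [hbR.2]) hV
  · obtain ⟨hneg, hrate⟩ := hright t r₁ r₂ ω Λ r hsep hk hΛ hω hω0 hr (by linarith [hbc.2]) hV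
    exact ⟨hneg, fun h => hrate h.le⟩

/-! ### Timelike Killing fields -/

/-- A lower bound for `-ρ² g(T + a x Ω₁, T + a x Ω₁)` which does not depend on `θ`. -/
def timeFun (M a x r : ℝ) : ℝ :=
  Delta M a r * (1 - a ^ 2 * x) ^ 2 - a ^ 2 * (1 - (r ^ 2 + a ^ 2) * x) ^ 2

theorem metric_killing (M : ℝ) (x : ℝ) {r : ℝ} (hr : r ≠ 0) (θ : ℝ) :
    metric M a r θ (T + (a * x) • Omega1) (T + (a * x) • Omega1) =
      -((Delta M a r * (1 - a ^ 2 * (Real.sin θ ^ 2 * x)) ^ 2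
        - Real.sin θ ^ 2 * (a ^ 2 * (1 - (r ^ 2 + a ^ 2) * x) ^ 2)) / rhoSq a r θ) := by
  have hρ : 0 < rhoSq a r θ := by
    unfold rhoSq
    positivity
  simp only [metric, T, Omega1, Pi.add_apply, Pi.smul_apply, smul_eq_mul, Pi.single_eq_same,
    Pi.single_eq_of_ne, ne_eq, Fin.reduceEq, not_false_eq_true, mul_zero, add_zero,
    zero_add, mul_one]
  field_simp
  ring

theorem timeFun_le (haM : |a| < M) {x r s : ℝ} (hx : 0 ≤ x) (hx' : x ≤ gammaPlus M a)
    (hr : rPlus M a < r) (hs : s ≤ 1) :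
    timeFun M a x r ≤
      Delta M a r * (1 - a ^ 2 * (s * x)) ^ 2 - s * (a ^ 2 * (1 - (r ^ 2 + a ^ 2) * x) ^ 2) := by
  have hD := Delta_pos haM hr
  have hax : a ^ 2 * x ≤ 1 := by
    have : a ^ 2 * x ≤ a ^ 2 * gammaPlus M a := by gcongr
    nlinarith [two_mul_gammaPlus_lt haM, mul_nonneg (sq_nonneg a) (gammaPlus_pos haM).le]
  have hsx : s * x ≤ x := mul_le_of_le_one_left hx hs
  have hfirst : (1 - a ^ 2 * x) ^ 2 ≤ (1 - a ^ 2 * (s * x)) ^ 2 :=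
    pow_le_pow_left₀ (by linarith) (by gcongr) 2
  have hsecond : s * (a ^ 2 * (1 - (r ^ 2 + a ^ 2) * x) ^ 2)
      ≤ a ^ 2 * (1 - (r ^ 2 + a ^ 2) * x) ^ 2 := mul_le_of_le_one_left (by positivity) hs
  unfold timeFun
  gcongr

theorem metric_le_of_le_timeFun (haM : |a| < M) {c x r R : ℝ} (hx : 0 ≤ x)
    (hx' : x ≤ gammaPlus M a) (hr : rPlus M a < r) (hrR : r ≤ R) (hc : 0 ≤ c)
    (h : c ≤ timeFun M a x r) (θ : ℝ) :
    metric M a r θ (T + (a * x) • Omega1) (T + (a * x) • Omega1) ≤ -(c / (R ^ 2 + a ^ 2)) := by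
  have hr0 : 0 < r := (rPlus_pos haM).trans hr
  have hρ : 0 < rhoSq a r θ := by
    unfold rhoSq
    positivity
  have hρR : rhoSq a r θ ≤ R ^ 2 + a ^ 2 := by
    have : a ^ 2 * Real.cos θ ^ 2 ≤ a ^ 2 :=
      mul_le_of_le_one_right (sq_nonneg a) (Real.cos_sq_le_one θ)
    unfold rhoSq
    gcongr
  have hnum := h.trans (timeFun_le haM hx hx' hr (Real.sin_sq_le_one θ))
  rw [metric_killing M x hr0.ne', neg_le_neg_iff]
  exact div_le_div₀ (hc.trans hnum) hnum hρ hρR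

theorem continuous_timeFun (x : ℝ) : Continuous (timeFun M a x) := by
  unfold timeFun Delta
  fun_prop

theorem timeFun_inv_pos (haM : |a| < M) {ρ : ℝ} (hρ : rPlus M a < ρ) :
    0 < timeFun M a (ρ ^ 2 + a ^ 2)⁻¹ ρ := by
  have hD := Delta_pos haM hρ
  have hρ0 : 0 < ρ := (rPlus_pos haM).trans hρ
  have hfirst : 1 - a ^ 2 * (ρ ^ 2 + a ^ 2)⁻¹ = ρ ^ 2 / (ρ ^ 2 + a ^ 2) := by
    field_simp
    ring
  rw [timeFun, mul_inv_cancel₀ (by positivity), hfirst, sub_self]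
  simp only [ne_eq, OfNat.ofNat_ne_zero, not_false_eq_true, zero_pow, mul_zero, sub_zero]
  positivity

/-! ### The trapped radius -/

theorem continuous_trapFun : Continuous (Function.uncurry (trapFun M a)) := by
  simp only [Function.uncurry_def, trapFun, cubic]
  fun_prop

theorem trapFun_rPlus (haM : |a| < M) (t : ℝ) :
    trapFun M a t (rPlus M a) = 2 * (rPlus M a - M) * (rPlus M a ^ 2 + a ^ 2 - t) := by
  rw [trapFun, cubic_rPlus haM, rPlus_sq haM]
  ring

theorem trapFun_rPlus_pos (haM : |a| < M) {t : ℝ} (ht : t < rPlus M a ^ 2 + a ^ 2) :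
    0 < trapFun M a t (rPlus M a) := by
  rw [trapFun_rPlus haM]
  exact mul_pos (by linarith [mass_lt_rPlus haM]) (sub_pos.2 ht)

theorem trapFun_secant_le (haM : |a| < M) (t : ℝ) {v w : ℝ} (hv : rPlus M a ≤ v) (hw : v ≤ w) :
    trapFun M a t (rPlus M a) * (w - v) + trapFun M a t w * (v - rPlus M a)
      ≤ trapFun M a t v * (w - rPlus M a) := by
  have hgaps : 0 ≤ (w - rPlus M a) * (w - v) * (v - rPlus M a) :=
    mul_nonneg (mul_nonneg (by linarith) (by linarith)) (by linarith)
  have := mul_nonneg hgaps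
    (show 0 ≤ 2 * (rPlus M a + v + w - 3 * M) by linarith [mass_lt_rPlus haM])
  unfold trapFun
  linarith [cubic_secant (M := M) (a := a) (rPlus M a) v w]

theorem trapFun_pos_of_lt_root (haM : |a| < M) {t ρ r : ℝ} (ht : t < rPlus M a ^ 2 + a ^ 2)
    (hρ : trapFun M a t ρ = 0) (hr : rPlus M a ≤ r) (hrρ : r < ρ) : 0 < trapFun M a t r := by
  have hsecant := trapFun_secant_le haM t hr hrρ.le
  have hpos := mul_pos (trapFun_rPlus_pos haM ht) (sub_pos.2 hrρ)
  rw [hρ, zero_mul, add_zero] at hsecant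
  exact pos_of_mul_pos_left (hpos.trans_le hsecant) (by linarith)

theorem trapFun_neg_of_root_lt (haM : |a| < M) {t ρ r : ℝ} (ht : t < rPlus M a ^ 2 + a ^ 2)
    (hρ : trapFun M a t ρ = 0) (hpρ : rPlus M a < ρ) (hρr : ρ < r) : trapFun M a t r < 0 := by
  have hsecant := trapFun_secant_le haM t hpρ.le hρr.le
  have hpos := mul_pos (trapFun_rPlus_pos haM ht) (sub_pos.2 hρr)
  rw [hρ, zero_mul] at hsecant
  exact neg_of_mul_neg_left (by linarith) (sub_pos.2 hpρ).le

theorem trapFun_neg_of_threshold (haM : |a| < M) {r : ℝ} (hr : rPlus M a < r) :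
    trapFun M a (rPlus M a ^ 2 + a ^ 2) r < 0 := by
  have hp := mass_lt_rPlus haM
  have hM := mass_pos haM
  set p := rPlus M a
  have hfactor : trapFun M a (p ^ 2 + a ^ 2) r
      = -2 * ((r - p) * (r ^ 2 + p * r - 3 * M * r + M * p)) := by
    unfold trapFun cubic
    linear_combination (-2 * M - 2 * r - 2 * (r - M)) * rPlus_sq haM
  have hquad : 0 < r ^ 2 + p * r - 3 * M * r + M * p := by
    nlinarith [mul_pos (sub_pos.2 hr) (sub_pos.2 hp), mul_pos (sub_pos.2 hp) (hM.trans hp),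
      sq_nonneg (r - p)]
  linarith [mul_pos (sub_pos.2 hr) hquad]

theorem inv_lt_of_gammaPlus_lt (haM : |a| < M) {γ : ℝ} (hγ : gammaPlus M a < γ) :
    γ⁻¹ < rPlus M a ^ 2 + a ^ 2 := by
  rw [← inv_gammaPlus haM]
  exact inv_strictAnti₀ (gammaPlus_pos haM) hγ

theorem exists_trapFun_eq_zero (haM : |a| < M) {t l : ℝ} (ht : 0 < t) (hl : l < 3 * M)
    (hpos : 0 < trapFun M a t l) : ∃ ρ ∈ Ioo l (3 * M), trapFun M a t ρ = 0 := by
  have hM := mass_pos haM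
  have hneg : trapFun M a t (3 * M) < 0 := by
    have hvalue : trapFun M a t (3 * M) = -(8 * (M * a ^ 2) + 4 * (M * t)) := by
      unfold trapFun cubic
      ring
    rw [hvalue, neg_lt_zero]
    positivity
  exact intermediate_value_Ioo' hl.le (continuous_trapFun.uncurry_left t).continuousOn
    ⟨hneg, hpos⟩

theorem exists_eventually_trapSep (haM : |a| < M) {t₀ ρ r₁ r₂ : ℝ}
    (ht₀ : t₀ < rPlus M a ^ 2 + a ^ 2) (hρ : trapFun M a t₀ ρ = 0) (hpρ : rPlus M a < ρ)
    (hr₁ : r₁ < ρ) (hr₂ : ρ < r₂) : ∃ c > 0, ∀ᶠ t in 𝓝 t₀, TrapSep M a c t r₁ r₂ := by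
  have hp := rPlus_pos haM
  obtain ⟨c₁, hc₁, hleft⟩ := exists_eventually_forall_le continuous_trapFun
    (isCompact_Icc (a := rPlus M a) (b := (r₁ + ρ) / 2)) (x₀ := t₀)
    fun r hr => trapFun_pos_of_lt_root haM ht₀ hρ hr.1 (by linarith [hr.2])
  obtain ⟨c₂, hc₂, hright⟩ := exists_eventually_forall_le (F := fun t r => -trapFun M a t r)
    continuous_trapFun.neg (isCompact_Icc (a := (ρ + r₂) / 2) (b := 10 * M)) (x₀ := t₀)
    fun r hr => neg_pos.2 (trapFun_neg_of_root_lt haM ht₀ hρ hpρ (by linarith [hr.1]))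
  set e := rPlus M a ^ 2 + a ^ 2 - t₀
  have he0 : 0 < e := sub_pos.2 ht₀
  obtain ⟨c, ⟨hc0, hcc₁⟩, ⟨-, hcc₂⟩, ⟨-, hce⟩, ⟨-, hcr₁⟩, -, hcr₂⟩ := Filter.nonempty_of_mem <|
    inter_mem (Ioc_mem_nhdsGT hc₁) <| inter_mem (Ioc_mem_nhdsGT hc₂) <|
    inter_mem (Ioc_mem_nhdsGT (half_pos he0)) <|
    inter_mem (Ioc_mem_nhdsGT (half_pos (sub_pos.2 hr₁)))
    (Ioc_mem_nhdsGT (half_pos (sub_pos.2 hr₂)))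
  have hnear : ∀ᶠ t in 𝓝 t₀, t < t₀ + e / 2 := gt_mem_nhds (by linarith)
  refine ⟨c, hc0, ?_⟩
  filter_upwards [hleft, hright, hnear] with t hleft hright ht
  have hroot : ∀ r, rPlus M a < r → c ≤ r ^ 2 + a ^ 2 - t := fun r hr => by
    have : rPlus M a ^ 2 ≤ r ^ 2 := by gcongr
    linarith
  exact ⟨fun r hr hr₁ => Or.inl ⟨hroot r hr, hcc₁.trans (hleft r ⟨hr.le, by linarith⟩)⟩,
    fun r hr hr₂ hr₃ => ⟨hroot r hr, le_neg.1 (hcc₂.trans (hright r ⟨by linarith, hr₃⟩))⟩⟩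

theorem exists_forall_trapSep_of_le (ha : a ≠ 0) (haM : |a| < M) :
    ∃ τ > 0, ∃ c > 0, ∀ t ≤ τ, TrapSep M a c t (2.05 * M) (11 * M) := by
  have hM := mass_pos haM
  have hp := rPlus_pos haM
  obtain ⟨c₁, hc₁, hcubic⟩ := isCompact_Icc.exists_forall_le'
    (f := cubic M a) (by unfold cubic; fun_prop) fun r hr => cubic_pos ha haM hr
  have hA : 0 < rPlus M a ^ 2 + a ^ 2 := by positivity
  obtain ⟨c, ⟨hc0, hcc₁⟩, ⟨-, hcA⟩, -, hcM⟩ := Filter.nonempty_of_mem <|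
    inter_mem (Ioc_mem_nhdsGT (half_pos hc₁)) <| inter_mem (Ioc_mem_nhdsGT (half_pos hA))
    (Ioc_mem_nhdsGT (show 0 < 0.05 * M by positivity))
  obtain ⟨τ, ⟨hτ0, hτA⟩, hτM⟩ := Filter.nonempty_of_mem <|
    inter_mem (Ioc_mem_nhdsGT (half_pos hA)) (eventually_mul_lt (2.2 * M) (half_pos hc₁))
  refine ⟨τ, hτ0, c, hc0, fun t ht => ⟨fun r hr hr₁ => Or.inl ⟨?_, ?_⟩, fun r hr hr₂ hr₃ => ?_⟩⟩
  · have : rPlus M a ^ 2 ≤ r ^ 2 := by gcongr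
    linarith
  · have hlin : 2 * (r - M) * t ≤ τ * (2.2 * M) := by
      have hrM : 0 ≤ r - M := by linarith [mass_lt_rPlus haM]
      calc 2 * (r - M) * t ≤ 2 * (r - M) * τ := by gcongr
        _ ≤ 2.2 * M * τ := mul_le_mul_of_nonneg_right (by linarith) hτ0.le
        _ = τ * (2.2 * M) := mul_comm _ _
    have := hcubic r ⟨hr.le, by linarith⟩
    unfold trapFun
    have hτM : τ * (2.2 * M) < c₁ / 2 := hτM
    linarith
  · linarith

theorem exists_eventually_trapSep_threshold (haM : |a| < M) :
    ∃ ρ > rPlus M a, ∀ q ∈ Ioo (rPlus M a) ρ, ∀ r₁ < q, ∀ r₂ > q, r₂ < ρ → ∃ c > 0,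
      ∀ᶠ γ in 𝓝[>] gammaPlus M a, TrapSep M a c γ⁻¹ r₁ r₂ := by
  have hp := rPlus_pos haM
  have hγp := gammaPlus_pos haM
  obtain ⟨ρ, hρ, c₁, hc₁, hslope⟩ := exists_le_minSlope haM
  obtain ⟨ε, hslope, hε⟩ := (hslope.and self_mem_nhdsWithin).exists
  refine ⟨ρ, hρ, fun q hq r₁ hr₁ r₂ hr₂ hr₂ρ => ?_⟩
  obtain ⟨c₂, hc₂, hright⟩ := exists_eventually_forall_le (F := fun t r => -trapFun M a t r)
    continuous_trapFun.neg (isCompact_Icc (a := q) (b := 10 * M)) (x₀ := (gammaPlus M a)⁻¹)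
    fun r hr => by
      rw [inv_gammaPlus haM]
      exact neg_pos.2 (trapFun_neg_of_threshold haM (hq.1.trans_le hr.1))
  have hqp : 0 < q ^ 2 - rPlus M a ^ 2 := sub_pos.2 (by gcongr; exact hq.1)
  obtain ⟨c, ⟨hc0, hcc₁⟩, ⟨-, hcc₂⟩, ⟨-, hcq⟩, ⟨-, hcr₁⟩, -, hcr₂⟩ := Filter.nonempty_of_mem <|
    inter_mem (Ioc_mem_nhdsGT hc₁) <| inter_mem (Ioc_mem_nhdsGT hc₂) <|
    inter_mem (Ioc_mem_nhdsGT hqp) <|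
    inter_mem (Ioc_mem_nhdsGT (sub_pos.2 hr₁)) (Ioc_mem_nhdsGT (sub_pos.2 hr₂))
  refine ⟨c, hc0, ?_⟩
  filter_upwards [((continuousAt_inv₀ hγp.ne').eventually hright).filter_mono nhdsWithin_le_nhds,
    Ioo_mem_nhdsGT (lt_add_of_pos_right _ hε)]
    with γ hright hγ
  refine ⟨fun r hr hr₁ => Or.inr ⟨inv_ne_zero (hγp.trans hγ.1).ne', ?_⟩, fun r hr hr₂ hr₃ => ?_⟩
  · rw [inv_inv]
    exact hcc₁.trans (hslope γ hγ.2.le r ⟨hr.le, by linarith⟩)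
  · have hqr : q ≤ r := by linarith
    have hqr2 : q ^ 2 ≤ r ^ 2 := pow_le_pow_left₀ (hp.trans hq.1).le hqr 2
    have ht := inv_lt_of_gammaPlus_lt haM hγ.1
    exact ⟨by linarith, le_neg.1 (hcc₂.trans (hright r ⟨hqr, hr₃⟩))⟩

/-! ### Windows -/

/-- What the proposition attaches to a range of ratios `ω / (a m)`: the coefficient `killing` of
`a Ω₁` in the Killing field (the paper's `α / a`) and the interval `[left, right]`. -/
structure Window where
  killing : ℝ
  left : ℝ
  right : ℝ

/-- `w` serves the generalised superradiant range `J`: its interval lies inside the barrier, for all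
ratios in `J`. -/
structure IsSuperWindow (M a l : ℝ) (J : Set ℝ) (w : Window) : Prop where
  killing_eq : w.killing = gammaPlus M a
  lt_left : l < w.left
  left_lt : w.left < w.right
  right_le : w.right ≤ 11 * M
  exists_le_superFun : ∃ c > 0, ∀ γ ∈ J, ∀ r ∈ Icc w.left w.right, c ≤ superFun M a γ r

/-- `w` serves the non-superradiant range `J`: its interval contains the trapped radii of all ratios
in `J`, and its Killing field is timelike there. -/
structure IsNonsuperWindow (M a l : ℝ) (J : Set ℝ) (w : Window) : Prop where
  killing_nonneg : 0 ≤ w.killing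
  killing_le : w.killing ≤ gammaPlus M a
  lt_left : l < w.left
  left_lt : w.left < w.right
  right_le : w.right ≤ 11 * M
  exists_le_timeFun : ∃ c > 0, ∀ r ∈ Icc w.left w.right, c ≤ timeFun M a w.killing r
  exists_trapSep : ∃ c > 0, ∀ γ ∈ J, TrapSep M a c γ⁻¹ w.left w.right

theorem IsSuperWindow.mono {l l' : ℝ} {J J' : Set ℝ} {w : Window} (h : IsSuperWindow M a l J w)
    (hl : l' ≤ l) (hJ : J' ⊆ J) : IsSuperWindow M a l' J' w :=
  { h with
    lt_left := hl.trans_lt h.lt_left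
    exists_le_superFun := h.exists_le_superFun.imp fun _ hc => ⟨hc.1, fun γ hγ => hc.2 γ (hJ hγ)⟩ }

theorem IsNonsuperWindow.mono {l l' : ℝ} {J J' : Set ℝ} {w : Window}
    (h : IsNonsuperWindow M a l J w) (hl : l' ≤ l) (hJ : J' ⊆ J) :
    IsNonsuperWindow M a l' J' w :=
  { h with
    lt_left := hl.trans_lt h.lt_left
    exists_trapSep := h.exists_trapSep.imp fun _ hc => ⟨hc.1, fun γ hγ => hc.2 γ (hJ hγ)⟩ }

theorem exists_isSuperWindow {l u γ ρ : ℝ} (hρ : ρ ∈ Ioo l u) (hu : u ≤ 11 * M)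
    (hpos : 0 < superFun M a γ ρ) :
    ∃ J ∈ 𝓝 γ, ∃ w, IsSuperWindow M a l J w ∧ w.right < u := by
  obtain ⟨r₁, hr₁, r₂, hr₂, c, hc, hev⟩ := exists_Icc_eventually_forall_le
    continuous_superFun hρ hpos
  exact ⟨_, hev, ⟨gammaPlus M a, r₁, r₂⟩, ⟨rfl, hr₁.1, hr₁.2.trans hr₂.1, hr₂.2.le.trans hu,
    c, hc, fun _ hγ => hγ⟩, hr₂.2⟩

theorem inv_sq_add_le_gammaPlus (haM : |a| < M) {ρ : ℝ} (hρ : rPlus M a ≤ ρ) :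
    (ρ ^ 2 + a ^ 2)⁻¹ ≤ gammaPlus M a := by
  have hp := rPlus_pos haM
  rw [← inv_inv (gammaPlus M a), inv_gammaPlus haM]
  gcongr

/-- `T + a (ρ² + a²)⁻¹ Ω₁` is a multiple of a principal null direction up to a radial vector, hence
timelike at the radius `ρ`. -/
theorem exists_Icc_le_timeFun (haM : |a| < M) {l u ρ : ℝ} (hpρ : rPlus M a < ρ)
    (hρ : ρ ∈ Ioo l u) : ∃ r₁ ∈ Ioo l ρ, ∃ r₂ ∈ Ioo ρ u, ∃ c > 0,
      ∀ r ∈ Icc r₁ r₂, c ≤ timeFun M a (ρ ^ 2 + a ^ 2)⁻¹ r := by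
  obtain ⟨r₁, hr₁, r₂, hr₂, c, hc, hev⟩ := exists_Icc_eventually_forall_le
    (F := fun _ : Unit => timeFun M a (ρ ^ 2 + a ^ 2)⁻¹) (x₀ := ())
    ((continuous_timeFun (M := M) (a := a) (ρ ^ 2 + a ^ 2)⁻¹).comp continuous_snd) hρ
    (timeFun_inv_pos haM hpρ)
  exact ⟨r₁, hr₁, r₂, hr₂, c, hc, hev.self_of_nhds⟩

theorem exists_isNonsuperWindow_threshold (ha : a ≠ 0) (haM : |a| < M) :
    ∃ l > rPlus M a, ∃ γ > gammaPlus M a, ∃ w,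
      IsNonsuperWindow M a l (Ioo (gammaPlus M a) γ) w := by
  obtain ⟨ρ, hρ, hsep⟩ := exists_eventually_trapSep_threshold haM
  have hp3 : rPlus M a < 11 * M := by linarith [rPlus_lt ha haM, mass_pos haM]
  obtain ⟨q, hpq, hq⟩ := exists_between (lt_min hρ hp3)
  obtain ⟨l, hpl, hlq⟩ := exists_between hpq
  obtain ⟨r₁, hr₁, r₂, hr₂, c, hc, htime⟩ := exists_Icc_le_timeFun haM hpq ⟨hlq, hq⟩
  have hr₂ρ := lt_min_iff.1 hr₂.2
  obtain ⟨c', hc', hsep⟩ := hsep q ⟨hpq, (lt_min_iff.1 hq).1⟩ r₁ hr₁.2 r₂ hr₂.1 hr₂ρ.1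
  obtain ⟨γ, hγ, hsub⟩ := mem_nhdsGT_iff_exists_Ioo_subset.1 hsep
  exact ⟨l, hpl, γ, hγ, ⟨(q ^ 2 + a ^ 2)⁻¹, r₁, r₂⟩, by positivity,
    inv_sq_add_le_gammaPlus haM hpq.le, hr₁.1, hr₁.2.trans hr₂.1, hr₂ρ.2.le,
    ⟨c, hc, htime⟩, c', hc', fun _ hγ => hsub hγ⟩

theorem exists_isNonsuperWindow (haM : |a| < M) {l γ : ℝ} (hγ : gammaPlus M a < γ)
    (hpl : rPlus M a ≤ l) (hl : l < 3 * M) (hpos : 0 < trapFun M a γ⁻¹ l) :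
    ∃ J ∈ 𝓝 γ, ∃ w, IsNonsuperWindow M a l J w := by
  have hγ0 : 0 < γ := (gammaPlus_pos haM).trans hγ
  obtain ⟨ρ, hρ, hroot⟩ := exists_trapFun_eq_zero haM (inv_pos.2 hγ0) hl hpos
  have hpρ : rPlus M a < ρ := hpl.trans_lt hρ.1
  have hρu : ρ < 11 * M := by linarith [hρ.2, mass_pos haM]
  obtain ⟨r₁, hr₁, r₂, hr₂, c, hc, htime⟩ := exists_Icc_le_timeFun haM hpρ ⟨hρ.1, hρu⟩
  obtain ⟨c', hc', hsep⟩ := exists_eventually_trapSep haM (inv_lt_of_gammaPlus_lt haM hγ) hroot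
    hpρ hr₁.2 hr₂.1
  exact ⟨{γ | TrapSep M a c' γ⁻¹ r₁ r₂}, (continuousAt_inv₀ hγ0.ne').eventually hsep,
    ⟨(ρ ^ 2 + a ^ 2)⁻¹, r₁, r₂⟩, by positivity, inv_sq_add_le_gammaPlus haM hpρ.le,
    hr₁.1, hr₁.2.trans hr₂.1, hr₂.2.le, ⟨c, hc, htime⟩, c', hc', fun _ hγ => hγ⟩

theorem eventually_trapFun_inv_pos (haM : |a| < M) {γ₀ : ℝ} (hγ₀ : gammaPlus M a < γ₀) :
    ∀ᶠ l in 𝓝 (rPlus M a), ∀ γ, γ₀ ≤ γ → 0 < trapFun M a γ⁻¹ l := by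
  have hγ₀0 : 0 < γ₀ := (gammaPlus_pos haM).trans hγ₀
  have hcont : Continuous (Function.uncurry fun r t => trapFun M a t r) := by
    simp only [Function.uncurry_def, trapFun, cubic]
    fun_prop
  obtain ⟨c, hc, hev⟩ := exists_eventually_forall_le hcont
    (isCompact_Icc (a := 0) (b := γ₀⁻¹)) (x₀ := rPlus M a)
    fun t ht => trapFun_rPlus_pos haM (ht.2.trans_lt (inv_lt_of_gammaPlus_lt haM hγ₀))
  filter_upwards [hev] with l hl γ hγ
  exact hc.trans_le (hl _ ⟨inv_nonneg.2 (hγ₀0.le.trans hγ), inv_anti₀ hγ₀0 hγ⟩)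

/-- The window of the two unbounded ranges, whose Killing field is `T`. -/
def farWindow (M : ℝ) : Window := ⟨0, 2.05 * M, 11 * M⟩

theorem exists_isNonsuperWindow_farWindow (ha : a ≠ 0) (haM : |a| < M) :
    ∃ τ > 0, ∀ l < 2.05 * M, IsNonsuperWindow M a l {γ | γ⁻¹ ≤ τ} (farWindow M) := by
  have hM := mass_pos haM
  obtain ⟨τ, hτ, c, hc, hsep⟩ := exists_forall_trapSep_of_le ha haM
  refine ⟨τ, hτ, fun l hl => ⟨le_rfl, (gammaPlus_pos haM).le, hl,
    mul_lt_mul_of_pos_right (by norm_num) hM, le_rfl, ⟨0.1 * M ^ 2, by positivity, fun r hr => ?_⟩,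
    c, hc, fun γ hγ => hsep _ hγ⟩⟩
  have htime : timeFun M a 0 r = r * (r - 2 * M) := by
    unfold timeFun Delta
    ring
  have hr1 : 2.05 * M ≤ r := hr.1
  calc 0.1 * M ^ 2 ≤ 2.05 * M * (0.05 * M) := by nlinarith
    _ ≤ r * (r - 2 * M) := mul_le_mul hr1 (by linarith) (by positivity) (by linarith)
    _ = timeFun M a (farWindow M).killing r := htime.symm

theorem exists_trapSep_farWindow (ha : a ≠ 0) (haM : |a| < M) :
    ∃ c > 0, TrapSep M a c 0 (farWindow M).left (farWindow M).right := by
  obtain ⟨τ, hτ, c, hc, hsep⟩ := exists_forall_trapSep_of_le ha haM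
  exact ⟨c, hc, hsep 0 hτ.le⟩

/-! ### The covering -/

theorem exists_list_cover {β : Type*} {P : Set ℝ → β → Prop}
    (hP : ∀ ⦃J J' b⦄, J' ⊆ J → P J b → P J' b) {p' p q q' : ℝ} (hp : p' < p) (hq : q < q')
    (h : ∀ γ ∈ Icc p q, ∃ J ∈ 𝓝 γ, ∃ b, P J b) :
    ∃ L : List (Set ℝ × β),
      (∀ x ∈ L, IsOpen x.1 ∧ IsConnected x.1 ∧ x.1 ⊆ Ioo p' q' ∧ P x.1 x.2) ∧
      Icc p q ⊆ ⋃ x ∈ L, x.1 := by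
  refine isCompact_Icc.induction_on ⟨[], by simp, by simp⟩
    (fun S S' hS ⟨L, hL, hcover⟩ => ⟨L, hL, hS.trans hcover⟩)
    (fun S S' ⟨L, hL, hcover⟩ ⟨L', hL', hcover'⟩ => ⟨L ++ L', ?_, ?_⟩) fun γ hγ => ?_
  · exact fun x hx => (List.mem_append.1 hx).elim (hL x) (hL' x)
  · simp only [List.mem_append, iUnion_or, iUnion_union_distrib]
    exact union_subset_union hcover hcover'
  · obtain ⟨J, hJ, b, hb⟩ := h γ hγ
    obtain ⟨u, v, huv, hsub⟩ := mem_nhds_iff_exists_Ioo_subset.1 <|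
      inter_mem hJ (Ioo_mem_nhds (hp.trans_le hγ.1) (hγ.2.trans_lt hq))
    refine ⟨Ioo u v, mem_nhdsWithin_of_mem_nhds (Ioo_mem_nhds huv.1 huv.2), [(Ioo u v, b)], ?_, ?_⟩
    · simp only [List.mem_singleton, forall_eq]
      exact ⟨isOpen_Ioo, isConnected_Ioo (huv.1.trans huv.2), hsub.trans inter_subset_right,
        hP (hsub.trans inter_subset_left) hb⟩
    · simp

theorem eventually_Ioo_subset {J : Set ℝ} {x : ℝ} (hJ : J ∈ 𝓝 x) :
    ∀ᶠ ε in 𝓝[>] 0, Ioo (x - ε) (x + ε) ⊆ J :=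
  eventually_nhdsGT_zero_of_antitone
    (fun _ _ hc h => (Ioo_subset_Ioo (by linarith) (by linarith)).trans h)
    ((nhds_basis_Ioo_pos x).mem_iff.1 hJ)

theorem eventually_exists_superWindow_cover (ha : a ≠ 0) (haM : |a| < M) :
    ∀ᶠ l in 𝓝[>] rPlus M a, ∀ᶠ ε in 𝓝[>] 0, ∃ (w₁ w₂ : Window) (L : List (Set ℝ × Window)),
      4 * M < w₁.left ∧ w₁.right < 6 * M ∧
      IsSuperWindow M a l (Ioo (-ε) ε) w₁ ∧
      IsSuperWindow M a l (Ioo (gammaPlus M a - ε) (gammaPlus M a + ε)) w₂ ∧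
      (∀ x ∈ L, IsOpen x.1 ∧ IsConnected x.1 ∧ x.1 ⊆ strictSuper M a ε ∧
        IsSuperWindow M a l x.1 x.2) ∧
      Icc ε (gammaPlus M a - ε) ⊆ ⋃ x ∈ L, x.1 := by
  have hM := mass_pos haM
  filter_upwards [(eventually_exists_superFun_pos ha haM).filter_mono nhdsWithin_le_nhds,
    nhdsWithin_le_nhds (Iio_mem_nhds (show rPlus M a < 4 * M by linarith [rPlus_lt ha haM]))]
    with l hl hl4
  have hlocal : ∀ γ ∈ Icc 0 (gammaPlus M a), ∃ J ∈ 𝓝 γ, ∃ w, IsSuperWindow M a l J w := by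
    intro γ hγ
    obtain ⟨ρ, hρ, hpos⟩ := hl γ hγ
    obtain ⟨J, hJ, w, hw, -⟩ := exists_isSuperWindow (u := 11 * M)
      ⟨hρ.1, hρ.2.trans_lt (by linarith)⟩ le_rfl hpos
    exact ⟨J, hJ, w, hw⟩
  obtain ⟨J₁, hJ₁, w₁, hw₁, hright⟩ := exists_isSuperWindow (l := 4 * M) (u := 6 * M)
    ⟨by linarith, by linarith⟩ (by linarith)
    (superFun_five_mul_pos ha haM le_rfl (by rw [zero_mul]; exact zero_le_one))
  obtain ⟨J₂, hJ₂, w₂, hw₂⟩ := hlocal _ ⟨(gammaPlus_pos haM).le, le_rfl⟩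
  filter_upwards [eventually_Ioo_subset hJ₁, eventually_Ioo_subset hJ₂, self_mem_nhdsWithin]
    with ε h₁ h₂ hε
  have hε : 0 < ε := hε
  rw [zero_sub, zero_add] at h₁
  obtain ⟨L, hL, hcover⟩ := exists_list_cover (P := IsSuperWindow M a l) (p' := ε / 2) (p := ε)
    (q := gammaPlus M a - ε) (q' := gammaPlus M a - ε / 2)
    (fun _ _ _ hJ hw => hw.mono le_rfl hJ) (by linarith) (by linarith)
    fun γ hγ => hlocal γ ⟨hε.le.trans hγ.1, hγ.2.trans (by linarith)⟩
  exact ⟨w₁, w₂, L, hw₁.lt_left, hright, hw₁.mono (le_of_lt hl4) h₁, hw₂.mono le_rfl h₂, hL,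
    hcover⟩

theorem Ioo_union_union_Ioi_eq {p q K : ℝ} {U : Set ℝ} (hpq : p < q) (hqK : q ≤ K)
    (hU : U ⊆ Ioi p) (hcover : Icc q K ⊆ U) : Ioo p q ∪ U ∪ Ioi K = Ioi p := by
  refine (union_subset (union_subset Ioo_subset_Ioi_self hU)
    (Ioi_subset_Ioi (hpq.le.trans hqK))).antisymm fun γ hγ => ?_
  rcases lt_or_ge γ q with hq | hq
  · exact Or.inl (Or.inl ⟨hγ, hq⟩)
  · exact (le_or_gt γ K).imp (fun hK => Or.inr (hcover ⟨hq, hK⟩)) id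

theorem eventually_exists_nonsuperWindow_cover (ha : a ≠ 0) (haM : |a| < M) :
    ∀ᶠ l in 𝓝[>] rPlus M a, ∀ᶠ ε in 𝓝[>] 0, ∀ δ ∈ Ioo 0 ε,
      ∃ (L : List (Set ℝ × Window)) (K : ℝ),
        (∀ x ∈ L, IsOpen x.1 ∧ IsConnected x.1 ∧ IsNonsuperWindow M a l x.1 x.2) ∧
        IsNonsuperWindow M a l (Ioi K) (farWindow M) ∧
        (⋃ x ∈ L, x.1) ∪ Ioi K = Ioi (gammaPlus M a + δ) := by
  have hM := mass_pos haM
  have hγp := gammaPlus_pos haM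
  have hp := rPlus_lt ha haM
  obtain ⟨l₀, hl₀, η, hη, w₀, hw₀⟩ := exists_isNonsuperWindow_threshold ha haM
  obtain ⟨τ, hτ, hfar⟩ := exists_isNonsuperWindow_farWindow ha haM
  have hη0 : 0 < η := hγp.trans hη
  filter_upwards [(eventually_trapFun_inv_pos haM hη).filter_mono nhdsWithin_le_nhds,
    Ioo_mem_nhdsGT (lt_min hl₀ (show rPlus M a < 2.05 * M by linarith))] with l hpos ⟨hpl, hl⟩
  obtain ⟨hll₀, hl2⟩ := lt_min_iff.1 hl
  set K := max τ⁻¹ η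
  obtain ⟨p', hp', hp'η⟩ := exists_between hη
  obtain ⟨L, hL, hcover⟩ := exists_list_cover (P := IsNonsuperWindow M a l) (p := η) (q := K)
    (fun _ _ _ hJ hw => hw.mono le_rfl hJ) hp'η (lt_add_one K)
    fun γ hγ => exists_isNonsuperWindow haM (hη.trans_le hγ.1) hpl.le (by linarith) (hpos γ hγ.1)
  filter_upwards [Ioo_mem_nhdsGT (sub_pos.2 hp')] with ε hε δ hδ
  refine ⟨(Ioo (gammaPlus M a + δ) η, w₀) :: L, K, ?_, ?_, ?_⟩
  · rintro x (_ | ⟨_, hx⟩)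
    · exact ⟨isOpen_Ioo, isConnected_Ioo (by linarith [hδ.2, hε.2]),
        hw₀.mono hll₀.le (Ioo_subset_Ioo_left (by linarith [hδ.1]))⟩
    · exact ⟨(hL x hx).1, (hL x hx).2.1, (hL x hx).2.2.2⟩
  · exact (hfar l hl2).mono le_rfl fun γ hγ =>
      inv_le_of_inv_le₀ hτ ((le_max_left _ _).trans (le_of_lt hγ))
  · have hδp' : gammaPlus M a + δ < p' := by linarith [hδ.2, hε.2]
    simp only [List.mem_cons, iUnion_iUnion_eq_or_left]
    exact Ioo_union_union_Ioi_eq (hδp'.trans hp'η) (le_max_right τ⁻¹ η)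
      (iUnion₂_subset fun x hx γ hγ => hδp'.trans ((hL x hx).2.2.1 hγ).1) hcover

theorem image_getD_Icc {β : Type*} (A B C : List β) (d : β) :
    (fun n => (A ++ B ++ C).getD (n - 1) d) '' Icc (A.length + 1) (A.length + B.length) =
      {x | x ∈ B} := by
  have hget : ∀ i < B.length, (A ++ B ++ C).getD (A.length + i) d = B.getD i d := fun i hi => by
    rw [List.append_assoc, List.getD_append_right _ _ _ _ (Nat.le_add_right _ _),
      Nat.add_sub_cancel_left, List.getD_append _ _ _ _ hi]
  ext x
  constructor
  · rintro ⟨n, hn, rfl⟩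
    obtain ⟨i, rfl⟩ := Nat.exists_eq_add_of_le hn.1
    have hi : i < B.length := by
      have := hn.2
      lia
    simp only [show A.length + 1 + i - 1 = A.length + i by lia, hget i hi,
      List.getD_eq_getElem _ _ hi]
    exact List.getElem_mem hi
  · intro hx
    obtain ⟨i, hi, rfl⟩ := List.getElem_of_mem hx
    exact ⟨A.length + 1 + i, ⟨by lia, by lia⟩, by
      simp only [show A.length + 1 + i - 1 = A.length + i by lia, hget i hi,
        List.getD_eq_getElem _ _ hi]⟩

theorem exists_enumeration {β : Type*} (e₁ e₂ f₁ f₂ : β) (L L' : List β) :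
    ∃ (Ns N : ℕ) (D : ℕ → β), 2 ≤ Ns ∧ Ns + 2 ≤ N ∧
      D 1 = e₁ ∧ D 2 = e₂ ∧ D (N - 1) = f₁ ∧ D N = f₂ ∧
      D '' Icc 1 Ns = {x | x ∈ e₁ :: e₂ :: L} ∧ D '' Icc 3 Ns = {x | x ∈ L} ∧
      D '' Icc (Ns + 1) N = {x | x ∈ L' ++ [f₁, f₂]} := by
  set S := e₁ :: e₂ :: L
  set B := L' ++ [f₁, f₂]
  set D : ℕ → β := fun n => (S ++ B).getD (n - 1) e₁ with hD
  have hB : B.length = L'.length + 2 := List.length_append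
  have hlast : ∀ i, D (S.length + L'.length + i + 1) = [f₁, f₂].getD i e₁ := fun i => by
    rw [hD, ← List.append_assoc]
    simp only [Nat.add_sub_cancel]
    rw [← List.length_append, List.getD_append_right _ _ _ _ (Nat.le_add_right _ _),
      Nat.add_sub_cancel_left]
  have hsuper := image_getD_Icc [] S B e₁
  have hmiddle := image_getD_Icc [e₁, e₂] L B e₁
  have hnonsuper := image_getD_Icc S B [] e₁
  rw [List.length_nil, zero_add, zero_add] at hsuper
  rw [List.append_nil] at hnonsuper
  refine ⟨S.length, S.length + B.length, D, Nat.le_add_left _ _, by lia, rfl, rfl, ?_, ?_, hsuper,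
    ?_, hnonsuper⟩
  · exact (congrArg D (by lia)).trans (hlast 0)
  · exact (congrArg D (by lia)).trans (hlast 1)
  · rw [← hmiddle, show S.length = [e₁, e₂].length + L.length from Nat.add_comm L.length 2]
    rfl

theorem iUnion_superWindow_cover {ε : ℝ} (hε : 0 < ε) (hεγ : ε ≤ gammaPlus M a)
    {L : List (Set ℝ × Window)} (hL : ∀ x ∈ L, x.1 ⊆ strictSuper M a ε)
    (hcover : Icc ε (gammaPlus M a - ε) ⊆ ⋃ x ∈ L, x.1) (w₁ w₂ : Window) :
    ⋃ x ∈ (Ioo (-ε) ε, w₁) :: (Ioo (gammaPlus M a - ε) (gammaPlus M a + ε), w₂) :: L, x.1 =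
      genSuper M a ε := by
  simp only [List.mem_cons, iUnion_iUnion_eq_or_left]
  refine Subset.antisymm (union_subset (Ioo_subset_Ioo_right (by linarith)) <|
    union_subset (Ioo_subset_Ioo_left (by linarith)) <| iUnion₂_subset fun x hx =>
      (hL x hx).trans (Ioo_subset_Ioo (by linarith) (by linarith))) fun γ hγ => ?_
  rcases lt_or_ge γ ε with h | h
  · exact Or.inl ⟨hγ.1, h⟩
  · rcases le_or_gt γ (gammaPlus M a - ε) with h' | h'
    · exact Or.inr (Or.inr (hcover ⟨h, h'⟩))
    · exact Or.inr (Or.inl ⟨h', hγ.2⟩)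

theorem eventually_exists_superWindow_list (ha : a ≠ 0) (haM : |a| < M) :
    ∀ᶠ l in 𝓝[>] rPlus M a, ∀ᶠ ε in 𝓝[>] 0, ∃ (w₁ w₂ : Window) (L S : List (Set ℝ × Window)),
      4 * M < w₁.left ∧ w₁.right < 6 * M ∧
      S = (Ioo (-ε) ε, w₁) :: (Ioo (gammaPlus M a - ε) (gammaPlus M a + ε), w₂) :: L ∧
      (∀ x ∈ L, x.1 ⊆ strictSuper M a ε) ∧
      (∀ x ∈ S, (IsOpen x.1 ∧ IsConnected x.1) ∧ IsSuperWindow M a l x.1 x.2) ∧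
      ⋃ x ∈ S, x.1 = genSuper M a ε := by
  filter_upwards [eventually_exists_superWindow_cover ha haM] with l hl
  filter_upwards [hl, Ioc_mem_nhdsGT (gammaPlus_pos haM)]
    with ε ⟨w₁, w₂, L, hleft, hright, hw₁, hw₂, hL, hcover⟩ ⟨hε, hεγ⟩
  refine ⟨w₁, w₂, L, _, hleft, hright, rfl, fun x hx => (hL x hx).2.2.1, ?_,
    iUnion_superWindow_cover hε hεγ (fun x hx => (hL x hx).2.2.1) hcover w₁ w₂⟩
  simp only [List.forall_mem_cons]
  exact ⟨⟨⟨isOpen_Ioo, isConnected_Ioo (by linarith)⟩, hw₁⟩,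
    ⟨⟨isOpen_Ioo, isConnected_Ioo (by linarith)⟩, hw₂⟩,
    fun x hx => ⟨⟨(hL x hx).1, (hL x hx).2.1⟩, (hL x hx).2.2.2⟩⟩

theorem eventually_exists_nonsuperWindow_list (ha : a ≠ 0) (haM : |a| < M) :
    ∀ᶠ l in 𝓝[>] rPlus M a, ∀ᶠ ε in 𝓝[>] 0, ∀ δ₁ ∈ Ioo 0 ε, ∀ δ₂ ∈ Ioo 0 ε,
      ∃ (L S : List (Set ℝ × Window)) (K : ℝ),
        S = L ++ [(Iio (-δ₁), farWindow M), (Ioi K, farWindow M)] ∧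
        (∀ x ∈ S, (IsOpen x.1 ∧ IsConnected x.1) ∧ IsNonsuperWindow M a l x.1 x.2) ∧
        ⋃ x ∈ S, x.1 = nonSuper M a δ₁ δ₂ := by
  obtain ⟨τ, hτ, hfar⟩ := exists_isNonsuperWindow_farWindow ha haM
  have hp : rPlus M a < 2.05 * M := by linarith [rPlus_lt ha haM, mass_pos haM]
  filter_upwards [eventually_exists_nonsuperWindow_cover ha haM, Ioo_mem_nhdsGT hp] with l hcov hl
  filter_upwards [hcov] with ε hcov δ₁ hδ₁ δ₂ hδ₂
  obtain ⟨L, K, hL, hK, hcover⟩ := hcov δ₂ hδ₂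
  have hneg : IsNonsuperWindow M a l (Iio (-δ₁)) (farWindow M) :=
    (hfar l hl.2).mono le_rfl fun γ (hγ : γ < -δ₁) =>
      (inv_nonpos.2 (by linarith [hδ₁.1])).trans hτ.le
  refine ⟨L, _, K, rfl, ?_, ?_⟩
  · simp only [List.forall_mem_append, List.forall_mem_cons]
    exact ⟨fun x hx => ⟨⟨(hL x hx).1, (hL x hx).2.1⟩, (hL x hx).2.2⟩,
      ⟨⟨isOpen_Iio, isConnected_Iio⟩, hneg⟩, ⟨⟨isOpen_Ioi, isConnected_Ioi⟩, hK⟩,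
      List.forall_mem_nil _⟩
  · simp only [List.mem_append, List.mem_cons, List.not_mem_nil, or_false, iUnion_or,
      iUnion_union_distrib, iUnion_iUnion_eq_left, nonSuper]
    rw [union_left_comm, hcover]

/-- The ranges `I n` with their windows `w n`, the first `Ns` of which are the generalised
superradiant ones. -/
structure IsRangeFamily (M a l ε δ₁ δ₂ : ℝ) (Ns N : ℕ) (I : ℕ → Set ℝ) (w : ℕ → Window) :
    Prop where
  left_gap : δ₁ ∈ Ioo 0 ε
  right_gap : δ₂ ∈ Ioo 0 ε
  two_le : 2 ≤ Ns
  add_two_le : Ns + 2 ≤ N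
  isOpen_isConnected : ∀ n ∈ Icc 1 N, IsOpen (I n) ∧ IsConnected (I n)
  isSuperWindow : ∀ n ∈ Icc 1 Ns, IsSuperWindow M a l (I n) (w n)
  isNonsuperWindow : ∀ n ∈ Icc (Ns + 1) N, IsNonsuperWindow M a l (I n) (w n)
  one_eq : I 1 = Ioo (-ε) ε
  window_one : 4 * M < (w 1).left ∧ (w 1).right < 6 * M
  two_eq : I 2 = Ioo (gammaPlus M a - ε) (gammaPlus M a + ε)
  subset_strictSuper : ∀ n ∈ Icc 3 Ns, I n ⊆ strictSuper M a ε
  iUnion_super : ⋃ n ∈ Icc 1 Ns, I n = genSuper M a ε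
  iUnion_nonsuper : ⋃ n ∈ Icc (Ns + 1) N, I n = nonSuper M a δ₁ δ₂
  not_bddBelow : ¬ BddBelow (I (N - 1))
  not_bddAbove : ¬ BddAbove (I N)
  window_far : w (N - 1) = farWindow M ∧ w N = farWindow M

theorem eventually_exists_isRangeFamily (ha : a ≠ 0) (haM : |a| < M) :
    ∀ᶠ l in 𝓝[>] rPlus M a, ∀ᶠ ε in 𝓝[>] 0, ∀ δ₁ ∈ Ioo 0 ε, ∀ δ₂ ∈ Ioo 0 ε,
      ∃ Ns N I w, IsRangeFamily M a l ε δ₁ δ₂ Ns N I w := by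
  filter_upwards [eventually_exists_superWindow_list ha haM,
    eventually_exists_nonsuperWindow_list ha haM] with l hsuper hnonsuper
  filter_upwards [hsuper, hnonsuper] with ε ⟨w₁, w₂, L, S, hleft, hright, hS, hL, hSw, hSε⟩
    hnonsuper δ₁ hδ₁ δ₂ hδ₂
  obtain ⟨L', S', K, hS', hS'w, hS'δ⟩ := hnonsuper δ₁ hδ₁ δ₂ hδ₂
  obtain ⟨Ns, N, D, hNs, hN, h₁, h₂, h₃, h₄, hDS, hDL, hDS'⟩ := exists_enumeration
    (Ioo (-ε) ε, w₁) (Ioo (gammaPlus M a - ε) (gammaPlus M a + ε), w₂)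
    (Iio (-δ₁), farWindow M) (Ioi K, farWindow M) L L'
  rw [← hS] at hDS
  rw [← hS'] at hDS'
  have hs := fun n hn => hSw (D n) (hDS.subset (mem_image_of_mem D hn))
  have hs' := fun n hn => hS'w (D n) (hDS'.subset (mem_image_of_mem D hn))
  exact ⟨Ns, N, fun n => (D n).1, fun n => (D n).2, {
    left_gap := hδ₁
    right_gap := hδ₂
    two_le := hNs
    add_two_le := hN
    isOpen_isConnected := fun n hn => (le_or_gt n Ns).elim (fun h => (hs n ⟨hn.1, h⟩).1)
      fun h => (hs' n ⟨h, hn.2⟩).1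
    isSuperWindow := fun n hn => (hs n hn).2
    isNonsuperWindow := fun n hn => (hs' n hn).2
    one_eq := congrArg Prod.fst h₁
    window_one := by
      rw [h₁]
      exact ⟨hleft, hright⟩
    two_eq := congrArg Prod.fst h₂
    subset_strictSuper := fun n hn => hL (D n) (hDL.subset (mem_image_of_mem D hn))
    iUnion_super := by
      rw [← hSε, ← biUnion_image (f := D) (g := Prod.fst), hDS]
      rfl
    iUnion_nonsuper := by
      rw [← hS'δ, ← biUnion_image (f := D) (g := Prod.fst), hDS']
      rfl
    not_bddBelow := by
      rw [h₃]
      exact not_bddBelow_Iio _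
    not_bddAbove := by
      rw [h₄]
      exact not_bddAbove_Ioi _
    window_far := ⟨congrArg Prod.snd h₃, congrArg Prod.snd h₄⟩ }⟩

namespace IsRangeFamily

variable {l ε δ₁ δ₂ : ℝ} {Ns N : ℕ} {I : ℕ → Set ℝ} {w : ℕ → Window}

theorem subset_genSuper (h : IsRangeFamily M a l ε δ₁ δ₂ Ns N I w) {n : ℕ} (hn : n ∈ Icc 1 Ns) :
    I n ⊆ genSuper M a ε :=
  (subset_biUnion_of_mem hn).trans h.iUnion_super.subset

theorem subset_nonSuper (h : IsRangeFamily M a l ε δ₁ δ₂ Ns N I w) {n : ℕ}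
    (hn : n ∈ Icc (Ns + 1) N) : I n ⊆ nonSuper M a δ₁ δ₂ :=
  (subset_biUnion_of_mem hn).trans h.iUnion_nonsuper.subset

theorem iUnion_eq_univ (h : IsRangeFamily M a l ε δ₁ δ₂ Ns N I w) :
    ⋃ n ∈ Icc 1 N, I n = univ := by
  have hcover : genSuper M a ε ∪ nonSuper M a δ₁ δ₂ = univ := by
    refine eq_univ_of_forall fun γ => ?_
    rcases lt_or_ge γ (-δ₁) with hγ | hγ
    · exact Or.inr (Or.inl hγ)
    · rcases lt_or_ge (gammaPlus M a + δ₂) γ with hγ' | hγ'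
      · exact Or.inr (Or.inr hγ')
      · exact Or.inl ⟨by linarith [h.left_gap.2], by linarith [h.right_gap.2]⟩
  rw [← univ_subset_iff, ← hcover, ← h.iUnion_super, ← h.iUnion_nonsuper]
  have hNs : Ns ≤ N := by linarith [h.add_two_le]
  exact union_subset (biUnion_subset_biUnion_left (Icc_subset_Icc_right hNs))
    (biUnion_subset_biUnion_left (Icc_subset_Icc_left (Nat.le_add_left 1 Ns)))

theorem exists_le_abs (h : IsRangeFamily M a l ε δ₁ δ₂ Ns N I w) (hε : ε ≤ gammaPlus M a / 2) :
    ∃ γ₀ > 0, ∀ n ∈ Icc 2 N, I n ⊆ {γ | γ₀ ≤ |γ|} := by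
  have hε0 : 0 < ε := h.left_gap.1.trans h.left_gap.2
  refine ⟨min (ε / 2) δ₁, lt_min (half_pos hε0) h.left_gap.1, fun n hn γ hγ => ?_⟩
  rcases le_or_gt n Ns with hns | hns
  · have hγ' : ε / 2 ≤ γ := by
      rcases hn.1.eq_or_lt with rfl | h2
      · rw [h.two_eq] at hγ
        linarith [hγ.1]
      · exact (h.subset_strictSuper n ⟨h2, hns⟩ hγ).1.le
    exact (min_le_left _ _).trans (hγ'.trans (le_abs_self γ))
  · rcases h.subset_nonSuper ⟨hns, hn.2⟩ hγ with hγ | hγ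
    · exact (min_le_right _ _).trans (le_neg.1 (le_of_lt hγ) |>.trans (neg_le_abs γ))
    · have hγ' : gammaPlus M a + δ₂ < γ := hγ
      have hεγ : ε / 2 ≤ γ := by linarith [h.right_gap.1]
      exact (min_le_left _ _).trans (hεγ.trans (le_abs_self γ))

theorem exists_trapSep (h : IsRangeFamily M a l ε δ₁ δ₂ Ns N I w) (ha : a ≠ 0) (haM : |a| < M)
    {n : ℕ} (hn : n ∈ Icc (Ns + 1) N) :
    ∃ c > 0, ∀ ω m, InRange a I N n ω m →
      ∃ t, a * m = t * ω ∧ TrapSep M a c t (w n).left (w n).right := by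
  obtain ⟨c₁, hc₁, hsep⟩ := (h.isNonsuperWindow n hn).exists_trapSep
  obtain ⟨c₂, hc₂, hfar⟩ := exists_trapSep_farWindow ha haM
  refine ⟨min c₁ c₂, lt_min hc₁ hc₂, fun ω m hω => ?_⟩
  rcases hω with hω | hω
  · obtain ⟨γ, hγ, rfl⟩ := hω.exists_eq_mul ha
    have hγ0 : γ ≠ 0 := by
      rintro rfl
      rcases h.subset_nonSuper hn hγ with h0 | h0
      · linarith [mem_Iio.1 h0, h.left_gap.1]
      · linarith [mem_Ioi.1 h0, h.right_gap.1, gammaPlus_pos haM]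
    exact ⟨γ⁻¹, (inv_mul_cancel_left₀ hγ0 _).symm, (hsep γ hγ).mono (min_le_left _ _)⟩
  · have hw : w n = farWindow M ∧ m = 0 := by
      rcases hω with ⟨hnN, hm, -⟩ | ⟨hnN, hm, -⟩
      · exact ⟨by rw [← h.window_far.1, ← hnN, Nat.add_sub_cancel], hm⟩
      · exact ⟨by rw [← h.window_far.2, hnN], hm⟩
    refine ⟨0, by rw [hw.2, Int.cast_zero, mul_zero, zero_mul], ?_⟩
    rw [hw.1]
    exact hfar.mono (min_le_right _ _)

theorem eventually_nonsuperSlope (h : IsRangeFamily M a l ε δ₁ δ₂ Ns N I w) (ha : a ≠ 0)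
    (haM : |a| < M) {R : ℝ} (hR : 11 * M < R) :
    ∀ᶠ b in 𝓝[>] 0, ∀ n ∈ Icc (Ns + 1) N, ∀ ω m Λ, Admissible a ω m Λ → InRange a I N n ω m →
      NonsuperSlope M a b R (w n).left (w n).right ω m Λ := by
  refine (eventually_all_finite (finite_Icc _ _)).2 fun n hn => ?_
  obtain ⟨c, hc, hsep⟩ := h.exists_trapSep ha haM hn
  have hw := h.isNonsuperWindow n hn
  filter_upwards [Kerr.eventually_nonsuperSlope ha haM hc
    (show 5 * M ≤ R by linarith [mass_pos haM])] with b hb ω m Λ hadm hω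
  obtain ⟨t, ht, hsep⟩ := hsep ω m hω
  exact hb t _ _ ω m Λ (by linarith [hw.left_lt, hw.right_le]) hsep ht hadm

theorem eventually_metric_le (h : IsRangeFamily M a l ε δ₁ δ₂ Ns N I w) (haM : |a| < M)
    (hl : rPlus M a ≤ l) :
    ∀ᶠ b in 𝓝[>] 0, ∀ n ∈ Icc (Ns + 1) N, ∀ r ∈ Ioo (w n).left (w n).right, ∀ θ,
      metric M a r θ (T + (a * (w n).killing) • Omega1) (T + (a * (w n).killing) • Omega1)
        ≤ -b := by
  refine (eventually_all_finite (finite_Icc _ _)).2 fun n hn => ?_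
  have hw := h.isNonsuperWindow n hn
  obtain ⟨c, hc, htime⟩ := hw.exists_le_timeFun
  have hM := mass_pos haM
  filter_upwards [Ioc_mem_nhdsGT (show 0 < c / ((11 * M) ^ 2 + a ^ 2) by positivity)]
    with b hb r hr θ
  exact (metric_le_of_le_timeFun haM hw.killing_nonneg hw.killing_le
    (hl.trans_lt (hw.lt_left.trans hr.1)) (hr.2.le.trans hw.right_le) hc.le
    (htime r ⟨hr.1.le, hr.2.le⟩) θ).trans (neg_le_neg hb.2)

theorem exists_isBarrier (h : IsRangeFamily M a l ε δ₁ δ₂ Ns N I w) (ha : a ≠ 0) (haM : |a| < M)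
    (hl : rPlus M a ≤ l) (hε : ε * (2 * M * a ^ 2) ≤ rPlus M a - M) {c₁ : ℝ} (hc₁ : 0 < c₁)
    (hslope : ∀ γ ≤ gammaPlus M a + ε, c₁ ≤ minSlope M a γ (rPlus M a)) {n : ℕ}
    (hn : n ∈ Icc 1 Ns) :
    ∃ c > 0, ∀ ω m Λ, Admissible a ω m Λ → RatioIn a (I n) ω m →
      IsBarrier M a c (w n).left (w n).right (a * m) ω Λ := by
  have hM := mass_pos haM
  have hw := h.isSuperWindow n hn
  obtain ⟨c₂, hc₂, hsuper⟩ := hw.exists_le_superFun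
  refine ⟨min c₁ (c₂ / ((11 * M) ^ 2 + a ^ 2) ^ 2), by positivity, fun ω m Λ hadm hω => ?_⟩
  obtain ⟨γ, hγ, rfl⟩ := hω.exists_eq_mul ha
  have hγε := h.subset_genSuper hn hγ
  have hconcave : -γ * (2 * M * a ^ 2) ≤ ε * (2 * M * a ^ 2) := by
    gcongr
    linarith [hγε.1]
  exact isBarrier_of_le_superFun ha haM hc₂.le (hl.trans_lt hw.lt_left) hw.left_lt hw.right_le
    (hadm.pos hω.1) hadm.sq_le (hconcave.trans hε) (hslope γ hγε.2.le) (hsuper γ hγ)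

end IsRangeFamily

theorem eventually_forall_isRangeFamily_superSlope (ha : a ≠ 0) (haM : |a| < M) {l R : ℝ}
    (hl : rPlus M a ≤ l) (hR : 11 * M < R) :
    ∀ᶠ ε in 𝓝[>] 0, ∀ δ₁ δ₂ Ns N I w, IsRangeFamily M a l ε δ₁ δ₂ Ns N I w →
      ∀ᶠ b in 𝓝[>] 0, ∀ n ∈ Icc 1 Ns, ∀ ω m Λ, Admissible a ω m Λ → RatioIn a (I n) ω m →
        SuperSlope M a b R (w n).left (w n).right ω m Λ := by
  obtain ⟨ρ, hρ, c₁, hc₁, hslope⟩ := exists_le_minSlope haM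
  filter_upwards [hslope, self_mem_nhdsWithin,
    eventually_mul_lt (2 * M * a ^ 2) (sub_pos.2 (mass_lt_rPlus haM))]
    with ε hslope hε hεconcave δ₁ δ₂ Ns N I w h
  have hε0 : 0 < ε := hε
  refine (eventually_all_finite (finite_Icc _ _)).2 fun n hn => ?_
  obtain ⟨c, hc, hbarrier⟩ := h.exists_isBarrier ha haM hl hεconcave.le hc₁
    (fun γ hγ => hslope γ hγ _ ⟨le_rfl, hρ.le⟩) hn
  have hw := h.isSuperWindow n hn
  have hM := mass_pos haM
  have hγp := gammaPlus_pos haM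
  filter_upwards [eventually_superSlope ha haM hc
    (show 0 ≤ a ^ 2 * (gammaPlus M a + ε) ^ 2 by positivity) (show 0 < R by linarith)]
    with b hb ω m Λ hadm hω
  refine hb _ _ ω m Λ (hw.right_le.trans_lt hR) ?_ (hbarrier ω m Λ hadm hω)
  obtain ⟨γ, hγ, rfl⟩ := hω.exists_eq_mul ha
  have hγε := h.subset_genSuper hn hγ
  exact mul_sq_le hadm.sq_le (sq_le_sq' (by linarith [hγε.1]) hγε.2.le)

/-! ### Trapping degeneration functions -/

theorem exists_deriv_mul_sub_eq {f : ℝ → ℝ} {p r : ℝ}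
    (hf : ∀ s ∈ uIcc p r, DifferentiableAt ℝ f s) :
    ∃ z ∈ uIcc p r, f r - f p = deriv f z * (r - p) := by
  obtain ⟨z, hz, h⟩ := domain_mvt
    (fun s hs => (hf s hs).hasDerivAt.hasFDerivAt.hasFDerivWithinAt) (convex_uIcc p r)
    left_mem_uIcc right_mem_uIcc
  refine ⟨z, segment_eq_uIcc p r ▸ hz, h.trans ?_⟩
  rw [ContinuousLinearMap.toSpanSingleton_apply, smul_eq_mul, mul_comm]

theorem le_of_deriv_mul_sub_nonneg {f : ℝ → ℝ} {p r : ℝ}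
    (hf : ∀ s ∈ uIcc p r, DifferentiableAt ℝ f s) (hp : deriv f p = 0)
    (h : ∀ s ∈ uIcc p r, 0 ≤ deriv f s * (s - p)) : f p ≤ f r := by
  obtain ⟨z, hz, hfz⟩ := exists_deriv_mul_sub_eq hf
  rw [← sub_nonneg, hfz]
  have hz' := h z hz
  rcases eq_or_ne z p with rfl | hzp
  · rw [hp, zero_mul]
  · rcases mem_uIcc.1 hz with ⟨hpz, hzr⟩ | ⟨hrz, hzp'⟩
    · have hpz' : 0 < z - p := sub_pos.2 (hpz.lt_of_ne hzp.symm)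
      exact mul_nonneg (nonneg_of_mul_nonneg_left hz' hpz') (by linarith)
    · have hzp'' : z - p < 0 := sub_neg.2 (hzp'.lt_of_ne hzp)
      exact mul_nonneg_of_nonpos_of_nonpos (nonpos_of_mul_nonneg_left hz' hzp'') (by linarith)

theorem le_of_le_mul_of_le_one {x y w : ℝ} (hx : 0 ≤ x) (hw : w ∈ Ioc 0 1) (h : x ≤ w * y) :
    x ≤ y :=
  h.trans (mul_le_of_le_one_left (nonneg_of_mul_nonneg_right (hx.trans h) hw.1) hw.2)

theorem add_half_mul_sq_le_of_le_weighted_deriv {f w : ℝ → ℝ} {κ p r : ℝ} (hκ : 0 ≤ κ)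
    (hw : ∀ s ∈ uIcc p r, w s ∈ Ioc 0 1) (hf : ∀ s ∈ uIcc p r, DifferentiableAt ℝ f s)
    (hg : ∀ s ∈ uIcc p r, DifferentiableAt ℝ (fun s => w s * deriv f s) s)
    (hp : deriv f p = 0)
    (hconv : ∀ s ∈ uIcc p r, κ ≤ w s * deriv (fun s => w s * deriv f s) s) :
    f p + κ / 2 * (r - p) ^ 2 ≤ f r := by
  have hfirst : ∀ s ∈ uIcc p r, κ * (s - p) ^ 2 ≤ deriv f s * (s - p) := fun s hs => by
    have hsub := uIcc_subset_uIcc_left hs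
    obtain ⟨z, hz, hgz⟩ := exists_deriv_mul_sub_eq fun u hu => hg u (hsub hu)
    rw [hp, mul_zero, sub_zero] at hgz
    have hκz := le_of_le_mul_of_le_one hκ (hw z (hsub hz)) (hconv z (hsub hz))
    refine le_of_le_mul_of_le_one (by positivity) (hw s hs) ?_
    calc κ * (s - p) ^ 2
        ≤ deriv (fun s => w s * deriv f s) z * (s - p) ^ 2 := by gcongr
      _ = w s * (deriv f s * (s - p)) := by rw [← mul_assoc, hgz]; ring
  have hparabola : ∀ s, HasDerivAt (fun s => κ / 2 * (s - p) ^ 2) (κ * (s - p)) s := fun s => by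
    refine ((((hasDerivAt_id' s).sub_const p).pow 2).const_mul (κ / 2)).congr_deriv ?_
    norm_num
    ring
  have hderiv : ∀ s ∈ uIcc p r,
      HasDerivAt (fun s => f s - κ / 2 * (s - p) ^ 2) (deriv f s - κ * (s - p)) s :=
    fun s hs => (hf s hs).hasDerivAt.sub (hparabola s)
  have hle := le_of_deriv_mul_sub_nonneg (fun s hs => (hderiv s hs).differentiableAt)
    (by rw [(hderiv p left_mem_uIcc).deriv, hp, sub_self, mul_zero, sub_zero])
    (fun s hs => by rw [(hderiv s hs).deriv]; linarith [hfirst s hs])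
  simp only [sub_self] at hle
  linarith

theorem Delta_div_mem_Ioc (haM : |a| < M) {r : ℝ} (hr : rPlus M a < r) :
    Delta M a r / (r ^ 2 + a ^ 2) ∈ Ioc 0 1 := by
  have hr0 := (rPlus_pos haM).trans hr
  have hMr := mul_pos (mass_pos haM) hr0
  have hDelta := Delta_pos haM hr
  refine ⟨by positivity, (div_le_one (by positivity)).2 ?_⟩
  rw [Delta]
  linarith

theorem add_half_mul_sq_le_of_le_rStarDeriv (haM : |a| < M) {f : ℝ → ℝ} {κ p r : ℝ}
    (hκ : 0 ≤ κ) (hf : ContDiffOn ℝ 2 f (Ioi (rPlus M a))) (hpr : uIcc p r ⊆ Ioi (rPlus M a))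
    (hp : deriv f p = 0)
    (hconv : ∀ s ∈ uIcc p r, κ ≤ rStarDeriv M a (rStarDeriv M a f) s) :
    f p + κ / 2 * (r - p) ^ 2 ≤ f r := by
  refine add_half_mul_sq_le_of_le_weighted_deriv hκ (fun s hs => Delta_div_mem_Ioc haM (hpr hs))
    (fun s hs => ?_) (fun s hs => ?_) hp hconv
  · exact (hf.differentiableOn two_ne_zero).differentiableAt (Ioi_mem_nhds (hpr hs))
  · have hs0 : 0 < s := (rPlus_pos haM).trans (hpr hs)
    have hderiv : DifferentiableAt ℝ (deriv f) s :=
      ((hf.deriv_of_isOpen (m := 1) isOpen_Ioi (by norm_num)).differentiableOn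
        one_ne_zero).differentiableAt (Ioi_mem_nhds (hpr hs))
    refine DifferentiableAt.mul (DifferentiableAt.div ?_ (by fun_prop) (by positivity)) hderiv
    unfold Delta
    fun_prop

theorem IsInteriorMax.V0'_eq_zero {ω Λ r : ℝ} {m : ℤ} (h : IsInteriorMax M a ω m Λ r) :
    V0' M a ω m Λ r = 0 := by
  rw [V0', rStarDeriv, h.2.deriv_eq_zero, mul_zero]

theorem IsTrappingDegeneration.min_le (haM : |a| < M)
    {ωhigh εwidth α btrap κ ω Λ p r : ℝ} {m : ℤ} {χ : ℝ → ℝ → ℤ → ℝ → ℝ}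
    (hχ : IsTrappingDegeneration M a ωhigh εwidth α btrap κ χ) (hκ : 0 ≤ κ)
    (htrap : TrappedRange M a ωhigh εwidth α btrap ω m Λ) (hp : IsInteriorMax M a ω m Λ p)
    (hr : rPlus M a < r) : min (1 / 2) (κ / 2 * (r - p) ^ 2) ≤ χ r ω m Λ := by
  refine min_le_iff.2 (or_iff_not_imp_left.2 fun hwell => ?_)
  have hp0 := hχ.vanish p ω m Λ htrap hp
  have hsub : uIcc p r ⊆ {s | rPlus M a < s ∧ χ s ω m Λ ≤ 1 / 2} :=
    (hχ.single_well ω m Λ htrap).uIcc_subset ⟨hp.1, by rw [hp0]; norm_num⟩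
      ⟨hr, (not_le.1 hwell).le⟩
  have hmin : IsLocalMin (fun s => χ s ω m Λ) p := by
    filter_upwards [Ioi_mem_nhds hp.1] with s hs
    rw [hp0]
    exact hχ.nonneg s ω m Λ hs htrap.1.1
  have hle := add_half_mul_sq_le_of_le_rStarDeriv haM hκ
    ((hχ.smooth ω m Λ htrap).of_le (WithTop.coe_le_coe.2 (le_top : (2 : ℕ∞) ≤ ⊤)))
    (fun s hs => (hsub hs).1) hmin.deriv_eq_zero
    (fun s hs => hχ.convex s ω m Λ (hsub hs).1 htrap (hsub hs).2)
  rwa [hp0, zero_add] at hle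

theorem mul_Delta_mul_inv_sq_mul_nonneg (haM : |a| < M) {b x r : ℝ} (hb : 0 ≤ b) (hx : 0 ≤ x)
    (hr : rPlus M a ≤ r) : 0 ≤ b * Delta M a r * (r ^ 2)⁻¹ * x := by
  have := Delta_nonneg haM hr
  positivity

namespace SuperSlope

variable {b R r₁ r₂ ω Λ : ℝ} {m : ℤ}

theorem subset_Ioo (h : SuperSlope M a b R r₁ r₂ ω m Λ) :
    {r | rPlus M a < r ∧ V0 M a ω m Λ r - ω ^ 2 < b * ω ^ 2 ∧ 0 < V0' M a ω m Λ r}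
      ⊆ Ioo (rPlus M a) r₁ := fun r ⟨hr, hV, hV'⟩ =>
  ⟨hr, (h r hr hV.le).elim (fun hleft => hleft.1) fun hright => absurd hV' hright.2.1.not_gt⟩

theorem subset_Ioi (haM : |a| < M) (hb : 0 ≤ b) (h : SuperSlope M a b R r₁ r₂ ω m Λ) :
    {r | rPlus M a < r ∧ V0 M a ω m Λ r - ω ^ 2 < b * ω ^ 2 ∧ V0' M a ω m Λ r < 0}
      ⊆ Ioi r₂ := fun r ⟨hr, hV, hV'⟩ =>
  (h r hr hV.le).elim
    (fun hleft => absurd hV' (hleft.2.trans_le'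
      (mul_Delta_mul_inv_sq_mul_nonneg haM hb (sq_nonneg ω) hr.le)).not_gt)
    fun hright => hright.1

theorem Icc_subset (h : SuperSlope M a b R r₁ r₂ ω m Λ) (hr₁ : rPlus M a < r₁) :
    Icc r₁ r₂ ⊆ {r | rPlus M a < r ∧ b * ω ^ 2 ≤ V0 M a ω m Λ r - ω ^ 2} := fun r hr =>
  ⟨hr₁.trans_le hr.1, le_of_not_ge fun hV =>
    (h r (hr₁.trans_le hr.1) hV).elim (fun hleft => hleft.1.not_ge hr.1)
      fun hright => hright.1.not_ge hr.2⟩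

theorem eq_empty (h : SuperSlope M a b R r₁ r₂ ω m Λ) :
    {r | rPlus M a < r ∧ r < 2 * R ∧ |V0 M a ω m Λ r - ω ^ 2| ≤ b * ω ^ 2 ∧
      |V0' M a ω m Λ r| ≤ b * Delta M a r * (r ^ 2)⁻¹ * ω ^ 2} = ∅ := by
  refine eq_empty_of_forall_notMem fun r ⟨hr, hrR, hV, hV'⟩ => ?_
  rw [abs_le] at hV'
  rcases h r hr ((le_abs_self _).trans hV) with hleft | hright
  · exact hleft.2.not_ge hV'.2
  · exact (hright.2.2 hrR).not_ge hV'.1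

theorem not_trappedRange (haM : |a| < M) (hb : 0 ≤ b) (h : SuperSlope M a b R r₁ r₂ ω m Λ)
    {ωhigh εwidth α btrap : ℝ} (hbtrap : btrap ≤ b) :
    ¬ TrappedRange M a ωhigh εwidth α btrap ω m Λ := by
  rintro ⟨-, p, hp, hV⟩
  have hVb : V0 M a ω m Λ p - ω ^ 2 ≤ b * ω ^ 2 := (le_abs_self _).trans (hV.trans (by gcongr))
  rcases h p hp.1 hVb with hleft | hright
  · have hnonneg := mul_Delta_mul_inv_sq_mul_nonneg haM hb (sq_nonneg ω) hp.1.le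
    exact (hnonneg.trans_lt hleft.2).ne' hp.V0'_eq_zero
  · exact hright.2.1.ne hp.V0'_eq_zero

end SuperSlope

namespace NonsuperSlope

variable {b R r₁ r₂ ω Λ : ℝ} {m : ℤ}

theorem lt_of_V0'_nonpos (haM : |a| < M) (hb : 0 < b) (h : NonsuperSlope M a b R r₁ r₂ ω m Λ)
    {r : ℝ} (hr : rPlus M a < r) (hV : |V0 M a ω m Λ r - ω ^ 2| < b * ω ^ 2)
    (hV' : V0' M a ω m Λ r ≤ 0) : r₁ + b < r := by
  by_contra! hr₁
  have hω : 0 < ω ^ 2 := pos_of_mul_pos_right ((abs_nonneg _).trans_lt hV) hb.le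
  have hr0 := (rPlus_pos haM).trans hr
  have hDelta := Delta_pos haM hr
  have hpos : 0 < b * Delta M a r * (r ^ 2)⁻¹ * ω ^ 2 := by positivity
  exact (hpos.trans_le ((h r hr hV).1 hr₁)).not_ge hV'

theorem lt_of_V0'_nonneg (h : NonsuperSlope M a b R r₁ r₂ ω m Λ) {r : ℝ} (hr : rPlus M a < r)
    (hV : |V0 M a ω m Λ r - ω ^ 2| < b * ω ^ 2) (hV' : 0 ≤ V0' M a ω m Λ r) : r < r₂ - b :=
  lt_of_not_ge fun hr₂ => ((h r hr hV).2 hr₂).1.not_ge hV'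

theorem subset_Ioo (hb : 0 < b) (h : NonsuperSlope M a b R r₁ r₂ ω m Λ) :
    {r | rPlus M a < r ∧ |V0 M a ω m Λ r - ω ^ 2| < b * ω ^ 2 ∧ 0 < V0' M a ω m Λ r}
      ⊆ Ioo (rPlus M a) r₂ := fun _ ⟨hr, hV, hV'⟩ =>
  ⟨hr, (h.lt_of_V0'_nonneg hr hV hV'.le).trans (sub_lt_self _ hb)⟩

theorem subset_Ioi (haM : |a| < M) (hb : 0 < b) (h : NonsuperSlope M a b R r₁ r₂ ω m Λ) :
    {r | rPlus M a < r ∧ |V0 M a ω m Λ r - ω ^ 2| < b * ω ^ 2 ∧ V0' M a ω m Λ r < 0}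
      ⊆ Ioi r₁ := fun _ ⟨hr, hV, hV'⟩ =>
  (lt_add_of_pos_right _ hb).trans (h.lt_of_V0'_nonpos haM hb hr hV hV'.le)

theorem flat_subset_Ioo (hb : 0 < b) (h : NonsuperSlope M a b R r₁ r₂ ω m Λ) :
    {r | rPlus M a < r ∧ r < 2 * R ∧ |V0 M a ω m Λ r - ω ^ 2| < b * ω ^ 2 ∧
      |V0' M a ω m Λ r| < b * Delta M a r * (r ^ 2)⁻¹ * ω ^ 2} ⊆ Ioo r₁ r₂ := by
  rintro r ⟨hr, hrR, hV, hV'⟩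
  rw [abs_lt] at hV'
  obtain ⟨hleft, hright⟩ := h r hr hV
  constructor <;> by_contra! hout
  · exact hV'.2.not_ge (hleft (by linarith))
  · exact hV'.1.not_ge ((hright (by linarith)).2 hrR)

theorem min_le (haM : |a| < M) (hb : 0 < b) (h : NonsuperSlope M a b R r₁ r₂ ω m Λ)
    (hadm : Admissible a ω m Λ) {ωhigh εwidth α btrap κ : ℝ} {χ : ℝ → ℝ → ℤ → ℝ → ℝ}
    (hχ : IsTrappingDegeneration M a ωhigh εwidth α btrap κ χ) (hωhigh : 0 < ωhigh)
    (hbtrap : btrap < b) (hκ : 0 ≤ κ) {r : ℝ} (hr : rPlus M a < r) (hout : r ≤ r₁ ∨ r₂ ≤ r) :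
    min (1 / 2) (κ / 2 * b ^ 2) ≤ χ r ω m Λ := by
  by_cases htrap : TrappedRange M a ωhigh εwidth α btrap ω m Λ
  · obtain ⟨hnat, p, hp, hV⟩ := htrap
    have hω : 0 < ω ^ 2 := pow_pos (hωhigh.trans_le hnat.2.1) 2 |>.trans_eq (sq_abs ω)
    have hVb := hV.trans_lt (mul_lt_mul_of_pos_right hbtrap hω)
    have hp₁ := h.lt_of_V0'_nonpos haM hb hp.1 hVb hp.V0'_eq_zero.le
    have hp₂ := h.lt_of_V0'_nonneg hp.1 hVb hp.V0'_eq_zero.ge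
    have hdist : b ≤ |r - p| :=
      le_abs'.2 (hout.imp (fun _ => by linarith) fun _ => by linarith)
    calc min (1 / 2) (κ / 2 * b ^ 2) ≤ min (1 / 2) (κ / 2 * (r - p) ^ 2) := by
          rw [← sq_abs (r - p)]
          gcongr
      _ ≤ χ r ω m Λ := hχ.min_le haM hκ ⟨hnat, p, hp, hV⟩ hp hr
  · rw [hχ.eq_one r ω m Λ hr hadm htrap]
    exact (min_le_left _ _).trans (by norm_num)

end NonsuperSlope

/-- The estimates on the potential and on the Killing fields which hold in the ranges of an
`IsRangeFamily`, with one small constant `b` for the slopes and one constant `c` for the lower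
bounds. -/
structure HasPotentialEstimates (M a ρ R b c : ℝ) (Ns N : ℕ) (I : ℕ → Set ℝ) (w : ℕ → Window) :
    Prop where
  superSlope : ∀ n ∈ Icc 1 Ns, ∀ ω m Λ, Admissible a ω m Λ → RatioIn a (I n) ω m →
    SuperSlope M a b R (w n).left (w n).right ω m Λ
  nonsuperSlope : ∀ n ∈ Icc (Ns + 1) N, ∀ ω m Λ, Admissible a ω m Λ → InRange a I N n ω m →
    NonsuperSlope M a b R (w n).left (w n).right ω m Λ
  metric_le : ∀ n ∈ Icc (Ns + 1) N, ∀ r ∈ Ioo (w n).left (w n).right, ∀ θ,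
    metric M a r θ (T + (a * (w n).killing) • Omega1) (T + (a * (w n).killing) • Omega1) ≤ -b
  le_V0'_near_horizon : ∀ n ∈ Icc 1 Ns, ∀ ω m Λ, Admissible a ω m Λ → RatioIn a (I n) ω m →
    ∀ r ∈ Ioc (rPlus M a) ρ, c * (Delta M a r * (r ^ 2)⁻¹ * (Λ + ω ^ 2)) ≤ V0' M a ω m Λ r
  le_sq_add_V0 : ∀ n ∈ Icc 2 N, ∀ ω m Λ, Admissible a ω m Λ → RatioIn a (I n) ω m →
    ∀ r ∈ Icc (rPlus M a) (1.2 * R), ω ^ 2 ≤ V0 M a ω m Λ r →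
      c * (Delta M a r * Λ) ≤ ω ^ 2 + V0 M a ω m Λ r
  small_ratio : ∀ ω m Λ, Admissible a ω m Λ → RatioIn a (I 1) ω m →
    (∀ r ∈ Ioc (rPlus M a) (2.1 * M),
      c * (Delta M a r * (r ^ 2)⁻¹ * (Λ + ω ^ 2)) ≤ V0' M a ω m Λ r) ∧
    (∀ r ∈ Ici (2.01 * M), c * ((r ^ 2)⁻¹ * (Λ + ω ^ 2)) ≤ V0 M a ω m Λ r) ∧
    (∀ r ∈ Icc (2.01 * M) (1.2 * R), 1 / 2 * ω ^ 2 < V0 M a ω m Λ r)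

theorem IsRangeFamily.window_mem {l ε δ₁ δ₂ : ℝ} {Ns N : ℕ} {I : ℕ → Set ℝ} {w : ℕ → Window}
    (h : IsRangeFamily M a l ε δ₁ δ₂ Ns N I w) {n : ℕ} (hn : n ∈ Icc 1 N) :
    l < (w n).left ∧ (w n).left < (w n).right ∧ (w n).right ≤ 11 * M := by
  rcases le_or_gt n Ns with hns | hns
  · have hw := h.isSuperWindow n ⟨hn.1, hns⟩
    exact ⟨hw.lt_left, hw.left_lt, hw.right_le⟩
  · have hw := h.isNonsuperWindow n ⟨hns, hn.2⟩
    exact ⟨hw.lt_left, hw.left_lt, hw.right_le⟩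

theorem IsRangeFamily.zero_mem {l ε δ₁ δ₂ : ℝ} {Ns N : ℕ} {I : ℕ → Set ℝ} {w : ℕ → Window}
    (h : IsRangeFamily M a l ε δ₁ δ₂ Ns N I w) : 0 ∈ I 1 ∧ gammaPlus M a ∈ I 2 := by
  have hε := h.left_gap.1.trans h.left_gap.2
  rw [h.one_eq, h.two_eq]
  exact ⟨⟨neg_lt_zero.2 hε, hε⟩, sub_lt_self _ hε, lt_add_of_pos_right _ hε⟩

theorem IsRangeFamily.mul_killing_far_eq_zero {l ε δ₁ δ₂ : ℝ} {Ns N : ℕ} {I : ℕ → Set ℝ}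
    {w : ℕ → Window} (h : IsRangeFamily M a l ε δ₁ δ₂ Ns N I w) :
    a * (w (N - 1)).killing = 0 ∧ a * (w N).killing = 0 := by
  rw [h.window_far.1, h.window_far.2]
  exact ⟨mul_zero a, mul_zero a⟩

theorem IsSuperWindow.mul_killing_eq {l : ℝ} {J : Set ℝ} {w : Window}
    (h : IsSuperWindow M a l J w) : a * w.killing = a / (2 * M * rPlus M a) := by
  rw [h.killing_eq, gammaPlus, div_eq_mul_inv]

theorem IsNonsuperWindow.normalized_killing_mem (ha : a ≠ 0) (haM : |a| < M) {l : ℝ} {J : Set ℝ}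
    {w : Window} (h : IsNonsuperWindow M a l J w) :
    0 ≤ a * w.killing * (2 * M * rPlus M a) / a ∧
      a * w.killing * (2 * M * rPlus M a) / a ≤ 1 := by
  have hpos : 0 < 2 * M * rPlus M a := inv_pos.1 (gammaPlus_pos haM)
  rw [mul_assoc, mul_div_cancel_left₀ _ ha]
  exact ⟨mul_nonneg h.killing_nonneg hpos.le, (le_inv_mul_iff₀' hpos).1 (by
    rw [mul_one]; exact h.killing_le)⟩

namespace HasPotentialEstimates

variable {ρ R b c ωhigh εwidth α btrap κ : ℝ} {Ns N : ℕ} {I : ℕ → Set ℝ} {w : ℕ → Window}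
  {χ : ℝ → ℝ → ℤ → ℝ → ℝ}

theorem trapping_eq_one (haM : |a| < M) (est : HasPotentialEstimates M a ρ R b c Ns N I w)
    (hb : 0 ≤ b) (hbtrap : btrap ≤ b)
    (hχ : IsTrappingDegeneration M a ωhigh εwidth α btrap κ χ) :
    ∀ n ∈ Icc 1 Ns, ∀ (ω : ℝ) (m : ℤ) (Λ : ℝ), Admissible a ω m Λ → RatioIn a (I n) ω m →
      ∀ r, rPlus M a < r → χ r ω m Λ = 1 := fun n hn ω m Λ hadm hω r hr =>
  hχ.eq_one r ω m Λ hr hadm ((est.superSlope n hn ω m Λ hadm hω).not_trappedRange haM hb hbtrap)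

theorem min_le_trapping (haM : |a| < M) (est : HasPotentialEstimates M a ρ R b c Ns N I w)
    {l ε δ₁ δ₂ : ℝ} (h : IsRangeFamily M a l ε δ₁ δ₂ Ns N I w) (hl : rPlus M a < l)
    (hb : 0 < b) (hbtrap : btrap < b) (hωhigh : 0 < ωhigh) (hκ : 0 ≤ κ)
    (hχ : IsTrappingDegeneration M a ωhigh εwidth α btrap κ χ) :
    ∀ n ∈ Icc (Ns + 1) N, ∀ (ω : ℝ) (m : ℤ) (Λ : ℝ), Admissible a ω m Λ → InRange a I N n ω m →
      ∀ r ∈ Ioc (rPlus M a) (w n).left ∪ Ici (w n).right,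
        min (1 / 2) (κ / 2 * b ^ 2) ≤ χ r ω m Λ := by
  intro n hn ω m Λ hadm hω r hr
  have hw := h.isNonsuperWindow n hn
  have hright : rPlus M a < (w n).right := hl.trans (hw.lt_left.trans hw.left_lt)
  exact (est.nonsuperSlope n hn ω m Λ hadm hω).min_le haM hb hadm hχ hωhigh hbtrap hκ
    (hr.elim And.left hright.trans_le) (hr.imp And.right id)

end HasPotentialEstimates

theorem exists_isRangeFamily_hasPotentialEstimates (ha : a ≠ 0) (haM : |a| < M) :
    ∃ r₀ > rPlus M a, r₀ ≤ 2.01 * M ∧ ∀ R > 11 * M, ∀ᶠ ε in 𝓝[>] 0, ∀ δ₁ ∈ Ioo 0 ε,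
      ∀ δ₂ ∈ Ioo 0 ε, ∃ Ns N I w, IsRangeFamily M a r₀ ε δ₁ δ₂ Ns N I w ∧
        ∃ b > 0, ∃ c > 0, HasPotentialEstimates M a r₀ R b c Ns N I w := by
  have hp : rPlus M a < 2.01 * M := by linarith [rPlus_lt ha haM, mass_pos haM]
  obtain ⟨ρ, hρ, c₁, hc₁, hhorizon⟩ := exists_mul_le_V0'_near_horizon ha haM
  obtain ⟨c₂, hc₂, hsmall⟩ := exists_forall_eventually_small_ratio_bounds ha haM
  obtain ⟨r₀, hfamily, hr₀, hr₀ρ⟩ := ((eventually_exists_isRangeFamily ha haM).and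
    (Ioc_mem_nhdsGT (lt_min hρ hp))).exists
  refine ⟨r₀, hr₀, hr₀ρ.trans (min_le_right _ _), fun R hR => ?_⟩
  have hR0 : 0 < 1.2 * R := by linarith [mass_pos haM]
  filter_upwards [hfamily, hhorizon, hsmall (1.2 * R),
    eventually_forall_isRangeFamily_superSlope ha haM hr₀.le hR,
    Ioc_mem_nhdsGT (half_pos (gammaPlus_pos haM))]
    with ε hfamily hhorizon hsmall hsuper hε δ₁ hδ₁ δ₂ hδ₂
  obtain ⟨Ns, N, I, w, h⟩ := hfamily δ₁ hδ₁ δ₂ hδ₂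
  obtain ⟨γ₀, hγ₀, hγ₀I⟩ := h.exists_le_abs hε.2
  obtain ⟨c₃, hc₃, hsum⟩ := exists_mul_le_sq_add_V0 ha haM hγ₀ hR0
  obtain ⟨b, hbsuper, hbnonsuper, hbmetric, hb⟩ := ((hsuper δ₁ δ₂ Ns N I w h).and <|
    (h.eventually_nonsuperSlope ha haM hR).and <|
    (h.eventually_metric_le haM hr₀.le).and self_mem_nhdsWithin).exists
  obtain ⟨c, ⟨hcc₁, hcc₂, hcc₃⟩, hc⟩ : ∃ c, (c ≤ c₁ ∧ c ≤ c₂ ∧ c ≤ c₃) ∧ 0 < c :=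
    ⟨min c₁ (min c₂ c₃), by simp only [← le_min_iff, le_refl], by positivity⟩
  refine ⟨Ns, N, I, w, h, b, hb, c, hc, hbsuper, hbnonsuper, hbmetric,
    fun n hn ω m Λ hadm hω r hr => ?_, fun n hn ω m Λ hadm hω r hr hV => ?_,
    fun ω m Λ hadm hω => ?_⟩
  · have := Delta_mul_inv_sq_mul_nonneg haM hadm hr.1.le
    exact (hhorizon ω m Λ hadm ⟨hω.1, h.subset_genSuper hn hω.2⟩ r
      ⟨hr.1, hr.2.trans (hr₀ρ.trans (min_le_left _ _))⟩).trans' (by gcongr)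
  · have := mul_nonneg (Delta_nonneg haM hr.1) hadm.nonneg
    exact (hsum ω m Λ ⟨hω.1, hγ₀I n hn hω.2⟩ r hr hV).trans' (by gcongr)
  · rw [h.one_eq] at hω
    have hΛ := hadm.nonneg
    obtain ⟨hslope, hV, hhalf⟩ := hsmall ω m Λ hadm hω
    refine ⟨fun r hr => ?_, fun r hr => (hV r hr).trans' (by gcongr), hhalf⟩
    have := Delta_mul_inv_sq_mul_nonneg haM hadm hr.1.le
    exact (hslope r hr).trans' (by gcongr)

end Kerr

end

open Kerr in
theorem propositionA4 (M a : ℝ) (ha : a ≠ 0) (haM : |a| < M) :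
    -- `r_pot` is sufficiently close to `r₊`, `R_pot` sufficiently large, `ε` sufficiently small
    ∃ r₀ R₀ : ℝ, rPlus M a < r₀ ∧ r₀ ≤ 2.01 * M ∧ 5 * M ≤ R₀ ∧
    ∀ Rpot : ℝ, R₀ < Rpot → ∃ ε₀ : ℝ, 0 < ε₀ ∧
    ∀ ε δ₁ δ₂ rpot : ℝ, 0 < ε → ε < ε₀ → 0 < δ₁ → δ₁ < ε → 0 < δ₂ → δ₂ < ε →
      rPlus M a < rpot → rpot < r₀ →
    ∃ (Ns N : ℕ) (I : ℕ → Set ℝ) (α r₁ r₂ : ℕ → ℝ) (b b' c : ℝ),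
      2 ≤ Ns ∧ Ns + 2 ≤ N ∧ 0 < b ∧ 0 < b' ∧ 0 < c ∧
      -- the covering
      (∀ n ∈ Icc 1 N, IsOpen (I n) ∧ IsConnected (I n)) ∧
      (⋃ n ∈ Icc 1 N, I n) = univ ∧
      (∀ n ∈ Icc 1 N, rpot < r₁ n ∧ r₁ n < r₂ n ∧ r₂ n < Rpot) ∧
      0 ∈ I 1 ∧ gammaPlus M a ∈ I 2 ∧
      (∀ n ∈ Icc 3 Ns, I n ⊆ strictSuper M a ε) ∧
      (⋃ n ∈ Icc 1 Ns, I n) = genSuper M a ε ∧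
      (⋃ n ∈ Icc (Ns + 1) N, I n) = nonSuper M a δ₁ δ₂ ∧
      ¬ BddBelow (I (N - 1)) ∧ ¬ BddAbove (I N) ∧
      -- the generalised superradiant ranges
      (∀ n ∈ Icc 1 Ns, α n = a / (2 * M * rPlus M a)) ∧
      (∀ n ∈ Icc 1 Ns, ∀ (ω : ℝ) (m : ℤ) (Λ : ℝ), Admissible a ω m Λ → RatioIn a (I n) ω m →
        {r | rPlus M a < r ∧ V0 M a ω m Λ r - ω ^ 2 < b * ω ^ 2 ∧ 0 < V0' M a ω m Λ r}
          ⊆ Ioo (rPlus M a) (r₁ n) ∧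
        {r | rPlus M a < r ∧ V0 M a ω m Λ r - ω ^ 2 < b * ω ^ 2 ∧ V0' M a ω m Λ r < 0}
          ⊆ Ioi (r₂ n) ∧
        Icc (r₁ n) (r₂ n) ⊆ {r | rPlus M a < r ∧ b * ω ^ 2 ≤ V0 M a ω m Λ r - ω ^ 2} ∧
        {r | rPlus M a < r ∧ r < 2 * Rpot ∧ |V0 M a ω m Λ r - ω ^ 2| ≤ b * ω ^ 2 ∧
          |V0' M a ω m Λ r| ≤ b' * Delta M a r * (r ^ 2)⁻¹ * ω ^ 2} = ∅ ∧
        (∀ r ∈ Ioc (rPlus M a) rpot,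
          c * (Delta M a r * (r ^ 2)⁻¹ * (Λ + ω ^ 2)) ≤ V0' M a ω m Λ r)) ∧
      -- all ranges other than the first
      (∀ n ∈ Icc 2 N, ∀ (ω : ℝ) (m : ℤ) (Λ : ℝ), Admissible a ω m Λ → RatioIn a (I n) ω m →
        ∀ r ∈ Icc (rPlus M a) (1.2 * Rpot), ω ^ 2 ≤ V0 M a ω m Λ r →
          c * (Delta M a r * Λ) ≤ ω ^ 2 + V0 M a ω m Λ r) ∧
      -- the first range
      Icc (r₁ 1) (r₂ 1) ⊆ Ioo (4 * M) (6 * M) ∧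
      (∀ (ω : ℝ) (m : ℤ) (Λ : ℝ), Admissible a ω m Λ → RatioIn a (I 1) ω m →
        (∀ r ∈ Ioc (rPlus M a) (2.1 * M),
          c * (Delta M a r * (r ^ 2)⁻¹ * (Λ + ω ^ 2)) ≤ V0' M a ω m Λ r) ∧
        (∀ r ∈ Ici (2.01 * M), c * ((r ^ 2)⁻¹ * (Λ + ω ^ 2)) ≤ V0 M a ω m Λ r) ∧
        (∀ r ∈ Icc (2.01 * M) (1.2 * Rpot), 1 / 2 * ω ^ 2 < V0 M a ω m Λ r)) ∧
      -- the non-superradiant ranges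
      (∀ n ∈ Icc (Ns + 1) N, ∀ (ω : ℝ) (m : ℤ) (Λ : ℝ), Admissible a ω m Λ →
        InRange a I N n ω m →
        {r | rPlus M a < r ∧ |V0 M a ω m Λ r - ω ^ 2| < b * ω ^ 2 ∧ 0 < V0' M a ω m Λ r}
          ⊆ Ioo (rPlus M a) (r₂ n) ∧
        {r | rPlus M a < r ∧ |V0 M a ω m Λ r - ω ^ 2| < b * ω ^ 2 ∧ V0' M a ω m Λ r < 0}
          ⊆ Ioi (r₁ n) ∧
        {r | rPlus M a < r ∧ r < 2 * Rpot ∧ |V0 M a ω m Λ r - ω ^ 2| < b * ω ^ 2 ∧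
          |V0' M a ω m Λ r| < b' * Delta M a r * (r ^ 2)⁻¹ * ω ^ 2} ⊆ Ioo (r₁ n) (r₂ n)) ∧
      (∀ n ∈ Icc (Ns + 1) N, 0 ≤ α n * (2 * M * rPlus M a) / a ∧
        α n * (2 * M * rPlus M a) / a ≤ 1) ∧
      (∃ β : ℝ, β < 0 ∧ ∀ n ∈ Icc (Ns + 1) N, ∀ r ∈ Ioo (r₁ n) (r₂ n), ∀ θ ∈ Icc 0 Real.pi,
        metric M a r θ (T + α n • Omega1) (T + α n • Omega1) ≤ β) ∧
      α (N - 1) = 0 ∧ α N = 0 ∧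
      -- the trapping degeneration, for `b_trap` sufficiently small
      (∃ b₀ : ℝ, 0 < b₀ ∧ ∀ btrap : ℝ, 0 < btrap → btrap ≤ b₀ →
        ∀ ωhigh εwidth α' κ : ℝ, 0 < ωhigh → 0 < εwidth → 0 < α' → 0 < κ →
        ∃ c' : ℝ, 0 < c' ∧
        ∀ χ : ℝ → ℝ → ℤ → ℝ → ℝ, IsTrappingDegeneration M a ωhigh εwidth α' btrap κ χ →
          (∀ n ∈ Icc 1 Ns, ∀ (ω : ℝ) (m : ℤ) (Λ : ℝ), Admissible a ω m Λ → RatioIn a (I n) ω m →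
            ∀ r, rPlus M a < r → χ r ω m Λ = 1) ∧
          (∀ n ∈ Icc (Ns + 1) N, ∀ (ω : ℝ) (m : ℤ) (Λ : ℝ), Admissible a ω m Λ →
            InRange a I N n ω m →
            ∀ r ∈ Ioc (rPlus M a) (r₁ n) ∪ Ici (r₂ n), c' ≤ χ r ω m Λ)) := by
  obtain ⟨r₀, hr₀, hr₀M, hfamily⟩ := exists_isRangeFamily_hasPotentialEstimates ha haM
  refine ⟨r₀, 11 * M, hr₀, hr₀M, by linarith [mass_pos haM], fun R hR => ?_⟩
  obtain ⟨ε₀, hε₀, hfamily⟩ := mem_nhdsGT_iff_exists_Ioo_subset.1 (hfamily R hR)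
  refine ⟨ε₀, hε₀, fun ε δ₁ δ₂ rpot hε hεε₀ hδ₁ hδ₁ε hδ₂ hδ₂ε _ hrpot => ?_⟩
  obtain ⟨Ns, N, I, w, h, b, hb, c, hc, est⟩ :=
    hfamily ⟨hε, hεε₀⟩ δ₁ ⟨hδ₁, hδ₁ε⟩ δ₂ ⟨hδ₂, hδ₂ε⟩
  refine ⟨Ns, N, I, fun n => a * (w n).killing, fun n => (w n).left, fun n => (w n).right, b, b, c,
    h.two_le, h.add_two_le, hb, hb, hc, h.isOpen_isConnected, h.iUnion_eq_univ, fun n hn => ?_,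
    h.zero_mem.1, h.zero_mem.2, h.subset_strictSuper, h.iUnion_super, h.iUnion_nonsuper,
    h.not_bddBelow, h.not_bddAbove, fun n hn => (h.isSuperWindow n hn).mul_killing_eq,
    fun n hn ω m Λ hadm hω => ?_, est.le_sq_add_V0, Icc_subset_Ioo h.window_one.1 h.window_one.2,
    est.small_ratio, fun n hn ω m Λ hadm hω => ?_,
    fun n hn => (h.isNonsuperWindow n hn).normalized_killing_mem ha haM,
    ⟨-b, neg_lt_zero.2 hb, fun n hn r hr θ _ => est.metric_le n hn r hr θ⟩,
    h.mul_killing_far_eq_zero.1, h.mul_killing_far_eq_zero.2, b / 2, half_pos hb,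
    fun btrap _ hbtrap ωhigh εwidth α' κ hωhigh _ _ hκ => ⟨min (1 / 2) (κ / 2 * b ^ 2),
      by positivity, fun χ hχ => ⟨est.trapping_eq_one haM hb.le (by linarith) hχ,
        est.min_le_trapping haM h hr₀ hb (by linarith) hωhigh hκ.le hχ⟩⟩⟩
  · exact (h.window_mem hn).imp hrpot.trans (And.imp_right fun hw => hw.trans_lt hR)
  · have hslope := est.superSlope n hn ω m Λ hadm hω
    exact ⟨hslope.subset_Ioo, hslope.subset_Ioi haM hb.le,
      hslope.Icc_subset (hr₀.trans (h.isSuperWindow n hn).lt_left), hslope.eq_empty, fun r hr =>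
        est.le_V0'_near_horizon n hn ω m Λ hadm hω r ⟨hr.1, hr.2.trans hrpot.le⟩⟩
  · have hslope := est.nonsuperSlope n hn ω m Λ hadm hω
    exact ⟨hslope.subset_Ioo hb, hslope.subset_Ioi haM hb, hslope.flat_subset_Ioo hb⟩
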